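/- Let $d\ge 1$, $s\ge 0$, $0<q\le\infty$ and $0<p<1$. Write $\hat f(\xi)=\int_{\mathbb R^d} f(x)e^{-2\pi i x\cdot\xi}\,dx$, $T_a f(x)=f(x-a)$, $M_a f(x)=e^{2\pi i a\cdot x}f(x)$ and $\langle x\rangle=(1+|x|^2)^{1/2}$. Call $(\beta,\chi)$ an admissible pair if $\beta>0$, $\chi\in\mathcal S(\mathbb R^d)$, $\operatorname{supp}\hat\chi\subset\{|\xi|\le 1\}$ and $\sum_{k\in\mathbb Z^d}\hat\chi(\xi-\beta k)=1$ for all $\xi\in\mathbb R^d$. For an admissible pair $(\beta,\chi)$, the modulation space $M^{p,q}_{0,s}(\mathbb R^d)$ is the space of all tempered distributions $f$ with $$\|f\|_{M^{p,q}_{0,s}}=\Bigl(\sum_{k\in\mathbb Z^d}\|f*(M_{\beta k}\chi)\|_{L^p}^q\,\langle\beta k\rangle^{sq}\Bigr)^{1/q}<\infty$$ (a supremum over $k$ if $q=\infty$). For an admissible pair $(\beta',\chi')$, the Wiener amalgam space $W(\mathcal FL^p,\ell^\infty)(\mathbb R^d)$ is the space of all locally integrable functions $\sigma:\mathbb R^d\to\mathbb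 C$ with $$\|\sigma\|_{W(\mathcal FL^p,\ell^\infty)}=\sup_{n\in\mathbb Z^d}\|\mathcal F^{-1}(\sigma\cdot T_{\beta' n}\hat{\chi'})\|_{L^p}<\infty .$$ Let $(\beta,\chi)$ and $(\beta',\chi')$ be any admissible pairs (equal or not), used to define $M^{p,q}_{0,s}(\mathbb R^d)$ and $W(\mathcal FL^p,\ell^\infty)(\mathbb R^d)$ respectively, and let $\sigma\in W(\mathcal FL^p,\ell^\infty)(\mathbb R^d)$. Then, for every $f\in\mathcal S(\mathbb R^d)$, the function $\sigma\hat f$ is integrable, so that $$H_\sigma f(x)=\int_{\mathbb R^d}\sigma(\xi)\,\hat f(\xi)\,e^{2\pi i\xi\cdot x}\,d\xi$$ is well defined; moreover $\mathcal S(\mathbb R^d)\subset M^{p,q}_{0,s}(\mathbb R^d)$, and $H_\sigma$ extends to a bounded operator on $M^{p,q}_{0,s}(\mathbb R^d)$: there are a linear map $T:M^{p,q}_{0,s}(\mathbb R^d)\to M^{p,q}_{0,s}(\mathbb R^d)$ and a constant $C<\infty$ such that $Tf=H_\sigma f$ (as tempered distributions) for all $f\in\mathcal S(\mathbb R^d)$,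 and $\|Tf\|_{M^{p,q}_{0,s}}\le C\,\|f\|_{M^{p,q}_{0,s}}$ for all $f\in M^{p,q}_{0,s}(\mathbb R^d)$. -/

import Mathlib

open MeasureTheory SchwartzMap FourierTransform
open scoped ENNReal NNReal

noncomputable section

namespace FourierMult

/-- The space `ℝ^d` with its Euclidean norm. -/
abbrev Rd (d : ℕ) : Type := EuclideanSpace ℝ (Fin d)

variable {d : ℕ}

/-- The point `β k` of `ℝ^d`, for `k ∈ ℤ^d`. -/
def latticePoint (β : ℝ) (k : Fin d → ℤ) : Rd d :=
  β • WithLp.toLp 2 (fun i => (k i : ℝ))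

/-- The character `x ↦ e^{2 π i a · x}`. -/
def character (a : Rd d) (x : Rd d) : ℂ :=
  Complex.exp (2 * Real.pi * Complex.I * (inner ℝ a x : ℝ))

theorem hasTemperateGrowth_exp_mul_I :
    Function.HasTemperateGrowth
      (fun t : ℝ => Complex.exp (2 * Real.pi * Complex.I * (t : ℂ))) := by
  have hiter : ∀ n : ℕ, iteratedDeriv n
      (fun t : ℝ => Complex.exp (2 * Real.pi * Complex.I * (t : ℂ))) =
      fun t : ℝ => (2 * Real.pi * Complex.I) ^ n *
        Complex.exp (2 * Real.pi * Complex.I * (t : ℂ)) := by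
    intro n
    induction n with
    | zero => simp
    | succ n ih =>
      rw [iteratedDeriv_succ, ih]
      funext t
      have h1 : HasDerivAt (fun t : ℝ => 2 * Real.pi * Complex.I * (t : ℂ))
          (2 * Real.pi * Complex.I) t := by
        simpa using (Complex.ofRealCLM.hasDerivAt (x := t)).const_mul (2 * Real.pi * Complex.I)
      rw [(h1.cexp.const_mul ((2 * Real.pi * Complex.I) ^ n)).deriv]
      ring
  refine ⟨?_, fun n => ⟨0, (2 * Real.pi) ^ n, fun t => ?_⟩⟩
  · exact (contDiff_const.mul Complex.ofRealCLM.contDiff).cexp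
  · have hnorm : ‖Complex.exp (2 * Real.pi * Complex.I * (t : ℂ))‖ = 1 := by
      have : (2 * Real.pi * Complex.I * (t : ℂ)) = ((2 * Real.pi * t : ℝ) : ℂ) * Complex.I := by
        push_cast; ring
      rw [this, Complex.norm_exp_ofReal_mul_I]
    rw [norm_iteratedFDeriv_eq_norm_iteratedDeriv, hiter n]
    simp [hnorm, abs_of_pos Real.pi_pos]

theorem hasTemperateGrowth_character (a : Rd d) :
    Function.HasTemperateGrowth (character a) :=
  hasTemperateGrowth_exp_mul_I.comp (innerSL ℝ a).hasTemperateGrowth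

/-- Modulation `M_a φ (x) = e^{2 π i a · x} φ(x)` of a Schwartz function. -/
def modulate (a : Rd d) (φ : 𝓢(Rd d, ℂ)) : 𝓢(Rd d, ℂ) :=
  SchwartzMap.smulLeftCLM ℂ (character a) φ

theorem modulate_apply (a : Rd d) (φ : 𝓢(Rd d, ℂ)) (x : Rd d) :
    modulate a φ x = character a x * φ x := by
  simp [modulate, SchwartzMap.smulLeftCLM_apply_apply (hasTemperateGrowth_character a)]

/-- The Schwartz function `y ↦ φ (x - y)`. -/
def reflectAt (x : Rd d) (φ : 𝓢(Rd d, ℂ)) : 𝓢(Rd d, ℂ) :=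
  SchwartzMap.compSubConstCLM ℂ x
    (SchwartzMap.compCLMOfContinuousLinearEquiv ℂ
      (LinearIsometryEquiv.neg ℝ (E := Rd d)).toContinuousLinearEquiv φ)

theorem reflectAt_apply (x : Rd d) (φ : 𝓢(Rd d, ℂ)) (y : Rd d) :
    reflectAt x φ y = φ (x - y) := by
  simp [reflectAt, SchwartzMap.compSubConstCLM_apply]

/-- The convolution `f ∗ φ` of a tempered distribution with a Schwartz function. It is the
(smooth) function `x ↦ ⟨f, φ (x - ·)⟩`, for the bilinear pairing. -/
def conv (f : 𝓢'(Rd d, ℂ)) (φ : 𝓢(Rd d, ℂ)) (x : Rd d) : ℂ :=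
  f (reflectAt x φ)

/-- The pair `(β, χ)` is a frequency-uniform decomposition: `β > 0`, the Fourier transform of
`χ ∈ 𝓢` is supported in the closed unit ball, and its translates along `β ℤ^d` sum to one. -/
structure IsUniformDecomposition (β : ℝ) (χ : 𝓢(Rd d, ℂ)) : Prop where
  pos : 0 < β
  support_subset : ∀ ξ : Rd d, 1 < ‖ξ‖ → 𝓕 χ ξ = 0
  hasSum_one : ∀ ξ : Rd d, HasSum (fun k : Fin d → ℤ => 𝓕 χ (ξ - latticePoint β k)) 1

/-- The weight `⟨x⟩ ^ s = (1 + |x|²) ^ (s / 2)`. -/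
def weight (s : ℝ) (x : Rd d) : ℝ≥0∞ :=
  ENNReal.ofReal ((1 + ‖x‖ ^ 2) ^ (s / 2))

/-- The modulation space quasi-norm
`(∑_k ‖f ∗ (M_{β k} χ)‖_{L^p}^q ⟨β k⟩^{s q})^{1/q}` (a supremum over `k` if `q = ∞`), written as an
`ℓ^q` quasi-norm, that is, the `L^q` quasi-norm for the counting measure on `ℤ^d`. -/
def modNorm (p q : ℝ≥0∞) (s : ℝ) (β : ℝ) (χ : 𝓢(Rd d, ℂ)) (f : 𝓢'(Rd d, ℂ)) : ℝ≥0∞ :=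
  eLpNorm (fun k : Fin d → ℤ =>
    weight s (latticePoint β k) *
      eLpNorm (conv f (modulate (latticePoint β k) χ)) p volume) q Measure.count

theorem conv_add (f g : 𝓢'(Rd d, ℂ)) (φ : 𝓢(Rd d, ℂ)) :
    conv (f + g) φ = conv f φ + conv g φ := by
  funext x; simp [conv]

theorem conv_smul (c : ℂ) (f : 𝓢'(Rd d, ℂ)) (φ : 𝓢(Rd d, ℂ)) :
    conv (c • f) φ = c • conv f φ := by
  funext x; simp [conv]

theorem conv_zero (φ : 𝓢(Rd d, ℂ)) : conv (0 : 𝓢'(Rd d, ℂ)) φ = 0 := by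
  funext x; simp [conv]

/-- The modulation space `M^{p,q}_{0,s}(ℝ^d)`: the tempered distributions whose modulation space
quasi-norm is finite, as a linear subspace of the space of tempered distributions. (The
measurability that is part of `MemLp` holds automatically, `f ∗ (M_{β k} χ)` being smooth.) -/
def modulationSpace (p q : ℝ≥0∞) (s : ℝ) (β : ℝ) (χ : 𝓢(Rd d, ℂ)) :
    Submodule ℂ 𝓢'(Rd d, ℂ) where
  carrier := {f | (∀ k : Fin d → ℤ, MemLp (conv f (modulate (latticePoint β k) χ)) p volume) ∧
    modNorm p q s β χ f < ∞}
  zero_mem' := by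
    refine ⟨fun k => ?_, ?_⟩
    · rw [conv_zero]; exact MemLp.zero
    · simp only [modNorm, conv_zero, eLpNorm_zero, mul_zero]
      rw [show (fun _ : Fin d → ℤ => (0 : ℝ≥0∞)) = 0 from rfl, eLpNorm_zero]
      exact ENNReal.zero_lt_top
  add_mem' := by
    rintro f g ⟨hf, hf'⟩ ⟨hg, hg'⟩
    refine ⟨fun k => ?_, ?_⟩
    · rw [conv_add]; exact (hf k).add (hg k)
    · set F : (Fin d → ℤ) → ℝ≥0∞ := fun k => weight s (latticePoint β k) *
        eLpNorm (conv f (modulate (latticePoint β k) χ)) p volume with hF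
      set G : (Fin d → ℤ) → ℝ≥0∞ := fun k => weight s (latticePoint β k) *
        eLpNorm (conv g (modulate (latticePoint β k) χ)) p volume with hG
      have hm : ∀ H : (Fin d → ℤ) → ℝ≥0∞, AEStronglyMeasurable H Measure.count :=
        fun H => (measurable_of_countable H).aestronglyMeasurable
      have hsum : eLpNorm (F + G) q Measure.count < ∞ :=
        eLpNorm_add_lt_top ⟨hm F, hf'⟩ ⟨hm G, hg'⟩
      obtain ⟨c, hc⟩ : ∃ c : ℝ≥0, (c : ℝ≥0∞) = ENNReal.LpAddConst p :=
        ⟨_, ENNReal.coe_toNNReal (ENNReal.LpAddConst_lt_top p).ne⟩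
      refine lt_of_le_of_lt (b := (c : ℝ≥0∞) * eLpNorm (F + G) q Measure.count) ?_
        (ENNReal.mul_lt_top ENNReal.coe_lt_top hsum)
      refine eLpNorm_le_nnreal_smul_eLpNorm_of_ae_le_mul' (Filter.Eventually.of_forall fun k => ?_) q
      simp only [enorm_eq_self, conv_add, Pi.add_apply, hF, hG, hc]
      calc _ ≤ weight s (latticePoint β k) * (ENNReal.LpAddConst p *
            (eLpNorm (conv f (modulate (latticePoint β k) χ)) p volume +
              eLpNorm (conv g (modulate (latticePoint β k) χ)) p volume)) := by
            gcongr
            exact eLpNorm_add_le' (hf k).1 (hg k).1 p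
        _ = _ := by ring
  smul_mem' := by
    rintro c f ⟨hf, hf'⟩
    refine ⟨fun k => ?_, ?_⟩
    · rw [conv_smul]; exact (hf k).const_smul c
    · refine lt_of_le_of_lt (b := (‖c‖₊ : ℝ≥0∞) * modNorm p q s β χ f) ?_
        (ENNReal.mul_lt_top ENNReal.coe_lt_top hf')
      refine eLpNorm_le_nnreal_smul_eLpNorm_of_ae_le_mul' (Filter.Eventually.of_forall fun k => ?_) q
      simp only [enorm_eq_self, conv_smul, eLpNorm_const_smul, enorm_eq_nnnorm]
      exact le_of_eq (by ring)

/-- The quasi-norm of `h` in `𝓕L^p`, for an integrable function `h`: the `L^p` quasi-norm of its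
inverse Fourier transform. -/
def fourierLpNorm (p : ℝ≥0∞) (h : Rd d → ℂ) : ℝ≥0∞ :=
  eLpNorm (𝓕⁻ h) p volume

/-- The Wiener amalgam quasi-norm `sup_n ‖σ · T_{β n} χ̂‖_{𝓕L^p}`. -/
def wienerNorm (p : ℝ≥0∞) (β : ℝ) (χ : 𝓢(Rd d, ℂ)) (σ : Rd d → ℂ) : ℝ≥0∞ :=
  ⨆ n : Fin d → ℤ, fourierLpNorm p (fun ξ => σ ξ * 𝓕 χ (ξ - latticePoint β n))

/-- Functions in the Wiener amalgam space `W(𝓕L^p, ℓ^∞)(ℝ^d)`. Local integrability makes each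
`σ · T_{β n} χ̂` an integrable function, so that its Fourier transform is meaningful. -/
def MemWiener (p : ℝ≥0∞) (β : ℝ) (χ : 𝓢(Rd d, ℂ)) (σ : Rd d → ℂ) : Prop :=
  LocallyIntegrable σ volume ∧ wienerNorm p β χ σ < ∞

/-- The Fourier multiplier `H_σ f (x) = ∫ σ(ξ) f̂(ξ) e^{2 π i ξ · x} dξ` on Schwartz functions. -/
def fourierMultiplier (σ : Rd d → ℂ) (f : 𝓢(Rd d, ℂ)) (x : Rd d) : ℂ :=
  ∫ ξ, σ ξ * 𝓕 f ξ * character ξ x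

end FourierMult

end

open MeasureTheory SchwartzMap FourierTransform
open scoped ENNReal NNReal

noncomputable section

namespace FourierMult

variable {d : ℕ}

/-! ### Weighted derivatives of Schwartz functions as bounded functions -/

/-! Write f_k = f ∗ M_{βk}χ. Everything rests on a Nikolskii inequality for exponents P ≤ 1: if u
has spectrum in a ball of radius 2, then |u| ≤ |u| ∗ |Ψ| for a fixed kernel Ψ, and splitting |u| =
|u|^P |u|^{1-P} gives ‖u‖_∞^P ≤ A ∫|u|^P and (∫|u|)^P ≤ A^{1-P} ∫|u|^P (`Reproduced.enorm_rpow_le`,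
`lintegral_rpow_le_mul_lintegral_rpow`). Moving the ball only modulates Ψ, so A depends on d alone.
The absorption argument needs a finite weighted supremum beforehand. For f_k this is the polynomial
growth of f ∗ φ, obtained by factoring a tempered distribution through a Banach space of weighted
derivatives.

Young's inequality fails for P < 1, but it survives for band-limited functions: for fixed x, the
product y ↦ K(x - y) g(y) has spectrum in a ball of radius 2. So its L^1 norm is controlled by its
L^P quasi-norm, and Tonelli concludes (`lintegral_fourierInv_mul_fourier_rpow_le`).

Consequently σ is essentially bounded, since each localization of σ has an inverse transform in L^p,
hence in L^1. Since s ≥ 0, the pieces f_k are bounded in L^1 uniformly in k. Their Fourier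
transforms are compatible and glue to a bounded continuous function F with χ̂(· - βk) F = 𝓕 f_k
(`spectrumFun_mul`). The operator is Tf = 𝓕⁻¹(σF). This is defined on the whole space with no
density argument, so q = ∞ needs no separate treatment. It is linear in f, and F = f̂ for Schwartz
f.

The k-th piece of Tf is 𝓕⁻¹(σ 𝓕 f_k), a sum of convolutions of f_k with 𝓕⁻¹(σ · T_{β'n}χ̂'). Only
boundedly many n contribute, whatever k is, so the convolution estimate and P-subadditivity bound
this piece by a constant times f_k in L^p (`eLpNorm_fourierInv_symbol_mul_le`). Weighting and taking
ℓ^q norms preserves this bound. -/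

theorem exists_bound_one_add_norm_pow_mul (φ : 𝓢(Rd d, ℂ)) (k n : ℕ) :
    ∃ C : ℝ, 0 ≤ C ∧ ∀ x, (1 + ‖x‖) ^ k * ‖iteratedFDeriv ℝ n φ x‖ ≤ C :=
  ⟨_, by positivity, fun x => one_add_le_sup_seminorm_apply (𝕜 := ℂ) (m := (k, n)) le_rfl le_rfl φ x⟩

theorem one_add_norm_pow_le_mul (x y : Rd d) (k : ℕ) :
    (1 + ‖x‖) ^ k ≤ (1 + ‖y‖) ^ k * (1 + ‖x - y‖) ^ k := by
  rw [← mul_pow]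
  gcongr
  have : ‖x‖ ≤ ‖y‖ + ‖x - y‖ := by
    calc ‖x‖ = ‖y + (x - y)‖ := by congr 1; abel
      _ ≤ _ := norm_add_le _ _
  nlinarith [norm_nonneg y, norm_nonneg (x - y)]

/-- Continuous `n`-linear forms on `ℝ^d`, with the topology of their norm. -/
def MultiForm (d n : ℕ) : Type := Rd d [×n]→L[ℝ] ℂ

instance (n : ℕ) : NormedAddCommGroup (MultiForm d n) :=
  inferInstanceAs (NormedAddCommGroup (Rd d [×n]→L[ℝ] ℂ))

instance (n : ℕ) : NormedSpace ℂ (MultiForm d n) :=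
  inferInstanceAs (NormedSpace ℂ (Rd d [×n]→L[ℝ] ℂ))

instance (n : ℕ) : NormedSpace ℝ (MultiForm d n) :=
  inferInstanceAs (NormedSpace ℝ (Rd d [×n]→L[ℝ] ℂ))

instance (n : ℕ) : CompleteSpace (MultiForm d n) :=
  inferInstanceAs (CompleteSpace (Rd d [×n]→L[ℝ] ℂ))

/-- The `n`-th derivative as a function with values in `MultiForm d n`. -/
def nthDeriv (n : ℕ) (φ : 𝓢(Rd d, ℂ)) (x : Rd d) : MultiForm d n := iteratedFDeriv ℝ n φ x

theorem norm_nthDeriv (n : ℕ) (φ : 𝓢(Rd d, ℂ)) (x : Rd d) :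
    ‖nthDeriv n φ x‖ = ‖iteratedFDeriv ℝ n φ x‖ := rfl

theorem continuous_nthDeriv (n : ℕ) (φ : 𝓢(Rd d, ℂ)) : Continuous (nthDeriv n φ) :=
  (φ.smooth ⊤).continuous_iteratedFDeriv (mod_cast le_top)

theorem nthDeriv_add (n : ℕ) (φ ψ : 𝓢(Rd d, ℂ)) (x : Rd d) :
    nthDeriv n (φ + ψ) x = nthDeriv n φ x + nthDeriv n ψ x :=
  iteratedFDeriv_add_apply (𝕜 := ℝ) (i := n) (x := x) (φ.smooth n).contDiffAt
    (ψ.smooth n).contDiffAt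

theorem nthDeriv_smul (n : ℕ) (c : ℂ) (φ : 𝓢(Rd d, ℂ)) (x : Rd d) :
    nthDeriv n (c • φ) x = c • nthDeriv n φ x :=
  iteratedFDeriv_const_smul_apply (φ.smooth n).contDiffAt

/-- The bounded function `x ↦ (1 + |x|)^k D^n φ(x)`. -/
def weightedDeriv (k n : ℕ) :
    𝓢(Rd d, ℂ) →ₗ[ℂ] BoundedContinuousFunction (Rd d) (MultiForm d n) where
  toFun φ := BoundedContinuousFunction.ofNormedAddCommGroup
    (fun x => (((1 + ‖x‖) ^ k : ℝ) : ℂ) • nthDeriv n φ x)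
    ((Complex.continuous_ofReal.comp ((continuous_const.add continuous_norm).pow k)).smul
      (continuous_nthDeriv n φ))
    (exists_bound_one_add_norm_pow_mul φ k n).choose (fun x => by
      rw [norm_smul, Complex.norm_of_nonneg (by positivity)]
      exact (exists_bound_one_add_norm_pow_mul φ k n).choose_spec.2 x)
  map_add' φ ψ := by
    ext1 x
    exact (congrArg _ (nthDeriv_add n φ ψ x)).trans (smul_add _ _ _)
  map_smul' c φ := by
    ext1 x
    exact (congrArg _ (nthDeriv_smul n c φ x)).trans (smul_comm _ _ _)

theorem weightedDeriv_apply (k n : ℕ) (φ : 𝓢(Rd d, ℂ)) (x : Rd d) :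
    weightedDeriv k n φ x = (((1 + ‖x‖) ^ k : ℝ) : ℂ) • nthDeriv n φ x := rfl

theorem norm_weightedDeriv_apply (k n : ℕ) (φ : 𝓢(Rd d, ℂ)) (x : Rd d) :
    ‖weightedDeriv k n φ x‖ = (1 + ‖x‖) ^ k * ‖iteratedFDeriv ℝ n φ x‖ := by
  rw [weightedDeriv_apply, norm_smul, Complex.norm_of_nonneg (by positivity), norm_nthDeriv]

theorem seminorm_le_norm_weightedDeriv (k n : ℕ) (φ : 𝓢(Rd d, ℂ)) :
    SchwartzMap.seminorm ℂ k n φ ≤ ‖weightedDeriv k n φ‖ := by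
  refine SchwartzMap.seminorm_le_bound ℂ k n φ (norm_nonneg _) fun x => ?_
  refine le_trans ?_ ((weightedDeriv k n φ).norm_coe_le_norm x)
  rw [norm_weightedDeriv_apply]
  gcongr
  linarith

theorem iteratedFDeriv_compSubConst (φ : 𝓢(Rd d, ℂ)) (n : ℕ) (w y : Rd d) :
    iteratedFDeriv ℝ n (compSubConstCLM ℂ w φ) y = iteratedFDeriv ℝ n φ (y - w) := by
  have : ⇑(compSubConstCLM ℂ w φ) = fun y => φ (y - w) := by
    ext y; simp
  rw [this, iteratedFDeriv_comp_sub]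

theorem exists_norm_weightedDeriv_compSubConst_le (φ : 𝓢(Rd d, ℂ)) (k n : ℕ) :
    ∃ C : ℝ, 0 ≤ C ∧ ∀ w, ‖weightedDeriv k n (compSubConstCLM ℂ w φ)‖ ≤ C * (1 + ‖w‖) ^ k := by
  obtain ⟨C, hC, h⟩ := exists_bound_one_add_norm_pow_mul φ k n
  refine ⟨C, hC, fun w => (BoundedContinuousFunction.norm_le (by positivity)).2 fun y => ?_⟩
  rw [norm_weightedDeriv_apply, iteratedFDeriv_compSubConst]
  calc _ ≤ ((1 + ‖w‖) ^ k * (1 + ‖y - w‖) ^ k) * ‖iteratedFDeriv ℝ n φ (y - w)‖ := by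
        gcongr
        exact one_add_norm_pow_le_mul y w k
    _ = ((1 + ‖y - w‖) ^ k * ‖iteratedFDeriv ℝ n φ (y - w)‖) * (1 + ‖w‖) ^ k := by ring
    _ ≤ _ := by gcongr; exact h _

/-- The mean value inequality on the unit ball about y - w₀, with the decay of the derivative of
order n + 1. It makes translation norm-continuous, which yields continuity of f ∗ φ and
measurability of Bochner integrands. -/
theorem exists_norm_weightedDeriv_translate_sub_le (φ : 𝓢(Rd d, ℂ)) (k n : ℕ) :
    ∃ C : ℝ, 0 ≤ C ∧ ∀ w w₀ : Rd d, ‖w - w₀‖ ≤ 1 →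
      ‖weightedDeriv k n (compSubConstCLM ℂ w φ) - weightedDeriv k n (compSubConstCLM ℂ w₀ φ)‖ ≤
        C * (1 + ‖w₀‖) ^ k * ‖w - w₀‖ := by
  obtain ⟨C, hC, h⟩ := exists_bound_one_add_norm_pow_mul φ k (n + 1)
  -- The factor 2 ^ k comes from 1 + ‖y‖ ≤ 2 (1 + ‖u‖)(1 + ‖w₀‖) for u within distance 1 of y - w₀.
  refine ⟨C * 2 ^ k, by positivity, fun w w₀ hw =>
    (BoundedContinuousFunction.norm_le (by positivity)).2 fun y => ?_⟩
  rw [BoundedContinuousFunction.sub_apply, weightedDeriv_apply, weightedDeriv_apply, ← smul_sub,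
    norm_smul, Complex.norm_of_nonneg (by positivity), nthDeriv, nthDeriv,
    iteratedFDeriv_compSubConst, iteratedFDeriv_compSubConst]
  have key : ‖iteratedFDeriv ℝ n φ (y - w) - iteratedFDeriv ℝ n φ (y - w₀)‖ ≤
      (C * 2 ^ k * (1 + ‖w₀‖) ^ k / (1 + ‖y‖) ^ k) * ‖(y - w) - (y - w₀)‖ := by
    refine (convex_closedBall (y - w₀) 1).norm_image_sub_le_of_norm_fderiv_le (𝕜 := ℝ)
      (f := iteratedFDeriv ℝ n φ) (s := Metric.closedBall (y - w₀) 1) (fun x _ => ?_) (fun u hu => ?_) ?_ ?_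
    · exact ((φ.smooth ⊤).differentiable_iteratedFDeriv (mod_cast ENat.natCast_lt_top n)) x
    · rw [norm_fderiv_iteratedFDeriv, le_div_iff₀ (by positivity)]
      have hu' : ‖u - (y - w₀)‖ ≤ 1 := by simpa [dist_eq_norm] using hu
      calc ‖iteratedFDeriv ℝ (n + 1) φ u‖ * (1 + ‖y‖) ^ k
          ≤ ‖iteratedFDeriv ℝ (n + 1) φ u‖ * (((1 + ‖u‖) * 2) * (1 + ‖w₀‖)) ^ k := by
            gcongr
            have h1 : ‖y‖ ≤ ‖u‖ + ‖u - (y - w₀)‖ + ‖w₀‖ := by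
              calc ‖y‖ = ‖u - (u - (y - w₀)) + w₀‖ := by congr 1; abel
                _ ≤ ‖u - (u - (y - w₀))‖ + ‖w₀‖ := norm_add_le _ _
                _ ≤ _ := by gcongr; exact norm_sub_le _ _
            nlinarith [norm_nonneg u, norm_nonneg w₀, mul_nonneg (norm_nonneg u) (norm_nonneg w₀)]
        _ = ((1 + ‖u‖) ^ k * ‖iteratedFDeriv ℝ (n + 1) φ u‖) * 2 ^ k * (1 + ‖w₀‖) ^ k := by
            rw [mul_pow, mul_pow]; ring
        _ ≤ _ := by gcongr; exact h u
    · simp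
    · simpa [dist_eq_norm, norm_sub_rev] using hw
  calc _ ≤ (1 + ‖y‖) ^ k * ((C * 2 ^ k * (1 + ‖w₀‖) ^ k / (1 + ‖y‖) ^ k) *
        ‖(y - w) - (y - w₀)‖) := by gcongr; exact key
    _ = C * 2 ^ k * (1 + ‖w₀‖) ^ k * ‖(y - w) - (y - w₀)‖ := by
        field_simp
    _ = _ := by
        rw [show (y - w) - (y - w₀) = -(w - w₀) by abel, norm_neg]

/-- The family of weighted derivatives indexed by a finite set of orders. -/
def weightedDerivs (s : Finset (ℕ × ℕ)) : 𝓢(Rd d, ℂ) →ₗ[ℂ]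
    ((i : s) → BoundedContinuousFunction (Rd d) (MultiForm d i.1.2)) :=
  LinearMap.pi fun i => weightedDeriv i.1.1 i.1.2

theorem weightedDerivs_apply (s : Finset (ℕ × ℕ)) (φ : 𝓢(Rd d, ℂ)) (i : s) :
    weightedDerivs s φ i = weightedDeriv i.1.1 i.1.2 φ := rfl

theorem exists_norm_weightedDerivs_compSubConst_le (s : Finset (ℕ × ℕ)) (φ : 𝓢(Rd d, ℂ)) :
    ∃ (C : ℝ) (N : ℕ), 0 ≤ C ∧
      ∀ w, ‖weightedDerivs s (compSubConstCLM ℂ w φ)‖ ≤ C * (1 + ‖w‖) ^ N := by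
  choose C hC h using fun i : s => exists_norm_weightedDeriv_compSubConst_le φ i.1.1 i.1.2
  refine ⟨∑ i, C i, ∑ i : s, i.1.1, Finset.sum_nonneg fun i _ => hC i, fun w => ?_⟩
  refine (pi_norm_le_iff_of_nonneg (mul_nonneg (Finset.sum_nonneg fun i _ => hC i)
    (by positivity))).2 fun i => (h i w).trans ?_
  have h1 : C i ≤ ∑ i, C i :=
    Finset.single_le_sum (f := C) (fun j _ => hC j) (Finset.mem_univ i)
  have h2 : i.1.1 ≤ ∑ i : s, i.1.1 :=
    Finset.single_le_sum (f := fun i : s => i.1.1) (fun _ _ => Nat.zero_le _) (Finset.mem_univ i)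
  have h3 := Finset.sum_nonneg fun i (_ : i ∈ Finset.univ) => hC i
  gcongr
  linarith [norm_nonneg w]

theorem continuous_weightedDerivs_compSubConst (s : Finset (ℕ × ℕ)) (φ : 𝓢(Rd d, ℂ)) :
    Continuous fun w => weightedDerivs s (compSubConstCLM ℂ w φ) := by
  refine continuous_pi fun i => continuous_iff_continuousAt.2 fun w₀ => ?_
  obtain ⟨C, hC, h⟩ := exists_norm_weightedDeriv_translate_sub_le φ i.1.1 i.1.2
  rw [ContinuousAt, tendsto_iff_norm_sub_tendsto_zero]
  have h0 : Filter.Tendsto (fun w : Rd d => C * (1 + ‖w₀‖) ^ i.1.1 * ‖w - w₀‖) (nhds w₀)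
      (nhds 0) := by
    have : Continuous fun w : Rd d => C * (1 + ‖w₀‖) ^ i.1.1 * ‖w - w₀‖ := by fun_prop
    simpa using this.tendsto w₀
  refine squeeze_zero' (Filter.Eventually.of_forall fun _ => norm_nonneg _) ?_ h0
  filter_upwards [Metric.closedBall_mem_nhds w₀ one_pos] with w hw
  exact h w w₀ (by simpa [dist_eq_norm] using hw)

/-- A tempered distribution factors through finitely many weighted derivatives. -/
theorem exists_eq_weightedDerivs (f : 𝓢'(Rd d, ℂ)) :
    ∃ (s : Finset (ℕ × ℕ)) (Λ : StrongDual ℂ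
      ((i : s) → BoundedContinuousFunction (Rd d) (MultiForm d i.1.2))),
      ∀ φ, f φ = Λ (weightedDerivs s φ) := by
  set q : Seminorm ℂ 𝓢(Rd d, ℂ) := (normSeminorm ℂ ℂ).comp f.toLinearMap with hq
  have hqc : Continuous q := by
    change Continuous fun φ => ‖f φ‖
    exact (map_continuous f).norm
  obtain ⟨t, C, -, hC⟩ := Seminorm.bound_of_continuous (schwartz_withSeminorms ℂ (Rd d) ℂ) q hqc
  set s : Finset (ℕ × ℕ) := insert (0, 0) t with hs
  have hle : ∀ φ, ‖f φ‖ ≤ C * ‖weightedDerivs s φ‖ := fun φ => by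
    refine (hC φ).trans ?_
    rw [smul_apply, NNReal.smul_def, smul_eq_mul]
    gcongr
    refine Seminorm.finset_sup_apply_le (norm_nonneg _) fun i hi => ?_
    refine (seminorm_le_norm_weightedDeriv i.1 i.2 φ).trans ?_
    exact norm_le_pi_norm (weightedDerivs s φ) ⟨i, Finset.mem_insert_of_mem hi⟩
  have hinj : Function.Injective (weightedDerivs (d := d) s) := by
    rw [← LinearMap.ker_eq_bot, LinearMap.ker_eq_bot']
    intro φ hφ
    ext x
    have h1 := congrFun hφ ⟨(0, 0), Finset.mem_insert_self _ _⟩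
    have h2 := seminorm_le_norm_weightedDeriv 0 0 φ
    rw [weightedDerivs_apply] at h1
    simp only at h1
    rw [h1] at h2
    have h3 := (SchwartzMap.norm_le_seminorm ℂ φ x).trans h2
    simpa using h3
  set e := LinearEquiv.ofInjective _ hinj
  -- Hahn–Banach from the range to the whole Banach space, where Bochner integrals are available and
  -- commute with Λ.
  obtain ⟨Λ, hΛ, -⟩ := exists_extension_norm_eq (LinearMap.range (weightedDerivs (d := d) s))
    (LinearMap.mkContinuous (f.toLinearMap ∘ₗ e.symm.toLinearMap) C fun x => by
      obtain ⟨φ, rfl⟩ := e.surjective x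
      simp only [e, LinearMap.comp_apply, LinearEquiv.coe_coe, LinearEquiv.symm_apply_apply]
      exact hle φ)
  refine ⟨s, Λ, fun φ => ?_⟩
  have := hΛ (e φ)
  simp only [LinearMap.mkContinuous_apply, LinearMap.comp_apply, LinearEquiv.coe_coe,
    LinearEquiv.symm_apply_apply] at this
  exact this.symm

/-! ### Convolution of a tempered distribution with Schwartz functions -/

/-- The Schwartz function `y ↦ φ (-y)`. -/
def reflect (φ : 𝓢(Rd d, ℂ)) : 𝓢(Rd d, ℂ) :=
  SchwartzMap.compCLMOfContinuousLinearEquiv ℂ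
    (LinearIsometryEquiv.neg ℝ (E := Rd d)).toContinuousLinearEquiv φ

theorem reflect_apply (φ : 𝓢(Rd d, ℂ)) (y : Rd d) : reflect φ y = φ (-y) := by
  simp [reflect]

theorem reflectAt_eq (x : Rd d) (φ : 𝓢(Rd d, ℂ)) :
    reflectAt x φ = compSubConstCLM ℂ x (reflect φ) := rfl

theorem continuous_conv (f : 𝓢'(Rd d, ℂ)) (φ : 𝓢(Rd d, ℂ)) : Continuous (conv f φ) := by
  obtain ⟨s, Λ, h⟩ := exists_eq_weightedDerivs f
  have : conv f φ = fun x => Λ (weightedDerivs s (compSubConstCLM ℂ x (reflect φ))) :=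
    funext fun x => h _
  rw [this]
  exact Λ.continuous.comp (continuous_weightedDerivs_compSubConst s _)

theorem exists_norm_conv_le (f : 𝓢'(Rd d, ℂ)) (φ : 𝓢(Rd d, ℂ)) :
    ∃ (C : ℝ) (N : ℕ), 0 ≤ C ∧ ∀ x, ‖conv f φ x‖ ≤ C * (1 + ‖x‖) ^ N := by
  obtain ⟨s, Λ, h⟩ := exists_eq_weightedDerivs f
  obtain ⟨C, N, hC, hN⟩ := exists_norm_weightedDerivs_compSubConst_le s (reflect φ)
  refine ⟨‖Λ‖ * C, N, by positivity, fun x => ?_⟩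
  calc ‖conv f φ x‖ = ‖Λ (weightedDerivs s (compSubConstCLM ℂ x (reflect φ)))‖ := by
        rw [← h]; rfl
    _ ≤ ‖Λ‖ * (C * (1 + ‖x‖) ^ N) := (Λ.le_opNorm _).trans (by gcongr; exact hN x)
    _ = _ := by ring

/-- Convolution of Schwartz functions. -/
def schwartzConv (ψ φ : 𝓢(Rd d, ℂ)) : 𝓢(Rd d, ℂ) :=
  SchwartzMap.convolution (ContinuousLinearMap.mul ℂ ℂ) ψ φ

theorem schwartzConv_apply (ψ φ : 𝓢(Rd d, ℂ)) (x : Rd d) :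
    schwartzConv ψ φ x = ∫ t, ψ t * φ (x - t) := by
  rw [schwartzConv, SchwartzMap.convolution_apply]
  rfl

theorem fourier_schwartzConv (ψ φ : 𝓢(Rd d, ℂ)) (ξ : Rd d) :
    𝓕 (schwartzConv ψ φ) ξ = 𝓕 ψ ξ * 𝓕 φ ξ := by
  rw [schwartzConv, SchwartzMap.fourier_convolution, SchwartzMap.pairing_apply_apply]
  rfl

theorem eq_of_fourier_eq {φ ψ : 𝓢(Rd d, ℂ)} (h : ∀ ξ, 𝓕 φ ξ = 𝓕 ψ ξ) : φ = ψ := by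
  have h' : 𝓕 φ = 𝓕 ψ := SchwartzMap.ext h
  simpa using congrArg (fun θ : 𝓢(Rd d, ℂ) => 𝓕⁻ θ) h'

theorem schwartzConv_comm (ψ φ : 𝓢(Rd d, ℂ)) : schwartzConv ψ φ = schwartzConv φ ψ :=
  eq_of_fourier_eq fun ξ => by rw [fourier_schwartzConv, fourier_schwartzConv, mul_comm]

theorem reflect_schwartzConv (ψ φ : 𝓢(Rd d, ℂ)) :
    reflect (schwartzConv ψ φ) = schwartzConv (reflect ψ) (reflect φ) := by
  ext x
  rw [reflect_apply, schwartzConv_apply, schwartzConv_apply,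
    ← integral_neg_eq_self (fun t => ψ t * φ (-x - t))]
  congr 1 with t
  rw [reflect_apply, reflect_apply]
  congr 2
  abel

open LineDeriv in
theorem lineDeriv_schwartzConv (ψ φ : 𝓢(Rd d, ℂ)) (m : Rd d) :
    ∂_{m} (schwartzConv ψ φ) = schwartzConv ψ (∂_{m} φ) := by
  have hm : (fun ξ : Rd d => (inner ℝ ξ m : ℝ)).HasTemperateGrowth :=
    ((innerSL ℝ).flip m).hasTemperateGrowth
  refine eq_of_fourier_eq fun ξ => ?_
  rw [fourier_schwartzConv, SchwartzMap.fourier_lineDerivOp_eq, SchwartzMap.fourier_lineDerivOp_eq,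
    smul_apply, smul_apply, SchwartzMap.smulLeftCLM_apply_apply hm,
    SchwartzMap.smulLeftCLM_apply_apply hm, fourier_schwartzConv]
  simp only [smul_eq_mul, Complex.real_smul]
  ring

open LineDeriv in
theorem iteratedLineDeriv_schwartzConv (ψ φ : 𝓢(Rd d, ℂ)) {n : ℕ} (m : Fin n → Rd d) :
    ∂^{m} (schwartzConv ψ φ) = schwartzConv ψ (∂^{m} φ) := by
  induction n with
  | zero => simp
  | succ n ih => rw [iteratedLineDerivOp_succ_left, iteratedLineDerivOp_succ_left, ih,
      lineDeriv_schwartzConv]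

/-- Evaluation of a multilinear form. -/
def MultiForm.eval {n : ℕ} (m : Fin n → Rd d) : MultiForm d n →L[ℂ] ℂ :=
  LinearMap.mkContinuous
    { toFun := fun L : Rd d [×n]→L[ℝ] ℂ => L m
      map_add' := fun _ _ => rfl
      map_smul' := fun _ _ => rfl } (∏ i, ‖m i‖) fun L => by
    rw [mul_comm]
    exact ContinuousMultilinearMap.le_opNorm (𝕜 := ℝ) L m

open LineDeriv in
theorem MultiForm.eval_nthDeriv {n : ℕ} (m : Fin n → Rd d) (φ : 𝓢(Rd d, ℂ)) (x : Rd d) :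
    MultiForm.eval m (nthDeriv n φ x) = ∂^{m} φ x :=
  SchwartzMap.iteratedLineDerivOp_eq_iteratedFDeriv.symm

theorem MultiForm.ext_eval {n : ℕ} {L L' : MultiForm d n}
    (h : ∀ m, MultiForm.eval m L = MultiForm.eval m L') : L = L' :=
  ContinuousMultilinearMap.ext (f := (L : Rd d [×n]→L[ℝ] ℂ)) h

theorem integrable_one_add_norm_pow_mul (ψ : 𝓢(Rd d, ℂ)) (N : ℕ) :
    Integrable (fun t => (1 + ‖t‖) ^ N * ‖ψ t‖) volume := by
  have h := ((ψ.integrable_pow_mul volume N).const_mul (2 ^ N)).add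
    ((ψ.integrable (μ := volume)).norm.const_mul (2 ^ N))
  refine h.mono' (by fun_prop) (Filter.Eventually.of_forall fun t => ?_)
  rw [Real.norm_of_nonneg (by positivity)]
  have h1 : (1 + ‖t‖) ^ N ≤ 2 ^ N * ‖t‖ ^ N + 2 ^ N := by
    rcases le_total ‖t‖ 1 with ht | ht
    · calc (1 + ‖t‖) ^ N ≤ 2 ^ N := by gcongr; linarith
        _ ≤ _ := by simp
    · calc (1 + ‖t‖) ^ N ≤ (2 * ‖t‖) ^ N := by gcongr; linarith
        _ ≤ _ := by rw [mul_pow]; simp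
  calc _ ≤ (2 ^ N * ‖t‖ ^ N + 2 ^ N) * ‖ψ t‖ := by gcongr
    _ = _ := by simp only [Pi.add_apply]; ring

/-- Reflected translates of ψ ∗ φ are a superposition of those of φ with density ψ. As a
Banach-valued integral this can be checked by evaluating each derivative at each point, where it
says that derivatives of ψ ∗ φ fall on φ. Applying Λ then gives associativity. -/
theorem weightedDerivs_reflectAt_schwartzConv (s : Finset (ℕ × ℕ)) (ψ φ : 𝓢(Rd d, ℂ)) (x : Rd d) :
    Integrable (fun t => ψ t • weightedDerivs s (reflectAt (x - t) φ)) volume ∧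
    weightedDerivs s (reflectAt x (schwartzConv ψ φ)) =
      ∫ t, ψ t • weightedDerivs s (reflectAt (x - t) φ) := by
  have hint : Integrable (fun t => ψ t • weightedDerivs s (reflectAt (x - t) φ)) volume := by
    obtain ⟨C, N, hC, hN⟩ := exists_norm_weightedDerivs_compSubConst_le s (reflect φ)
    refine ((integrable_one_add_norm_pow_mul ψ N).const_mul (C * (1 + ‖x‖) ^ N)).mono' ?_
      (Filter.Eventually.of_forall fun t => ?_)
    · exact (ψ.continuous.smul ((continuous_weightedDerivs_compSubConst s (reflect φ)).comp
        (continuous_const.sub continuous_id))).aestronglyMeasurable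
    · rw [norm_smul]
      calc _ ≤ ‖ψ t‖ * (C * (1 + ‖x - t‖) ^ N) := by gcongr; exact hN _
        _ ≤ ‖ψ t‖ * (C * ((1 + ‖x‖) ^ N * (1 + ‖t‖) ^ N)) := by
            gcongr
            have := one_add_norm_pow_le_mul (x - t) x N
            simpa using this
        _ = _ := by ring
  refine ⟨hint, ?_⟩
  funext i
  ext1 y
  refine MultiForm.ext_eval fun m => ?_
  set ev : ((i : s) → BoundedContinuousFunction (Rd d) (MultiForm d i.1.2)) →L[ℂ] ℂ :=
    (MultiForm.eval m).comp ((BoundedContinuousFunction.evalCLM ℂ y).comp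
      (ContinuousLinearMap.proj i)) with hev
  have hev' : ∀ b, MultiForm.eval m (b i y) = ev b := fun b => rfl
  rw [hev', hev', ← ev.integral_comp_comm hint]
  have hval : ∀ (w : Rd d) (θ : 𝓢(Rd d, ℂ)), ev (weightedDerivs s (reflectAt w θ)) =
      (((1 + ‖y‖) ^ i.1.1 : ℝ) : ℂ) * (LineDeriv.iteratedLineDerivOp m (reflect θ)) (y - w) := by
    intro w θ
    rw [← hev', weightedDerivs_apply, weightedDeriv_apply, map_smul, smul_eq_mul, nthDeriv,
      reflectAt_eq, iteratedFDeriv_compSubConst]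
    congr 1
    exact MultiForm.eval_nthDeriv m (reflect θ) (y - w)
  simp only [map_smul, hval, smul_eq_mul]
  rw [reflect_schwartzConv, iteratedLineDeriv_schwartzConv, schwartzConv_apply,
    ← integral_neg_eq_self, ← integral_const_mul]
  congr 1 with t
  rw [reflect_apply, neg_neg, show y - x - -t = y - (x - t) by abel]
  ring

/-- Associativity: `ψ ∗ (f ∗ φ) = f ∗ (ψ ∗ φ)`. -/
theorem integral_mul_conv (f : 𝓢'(Rd d, ℂ)) (ψ φ : 𝓢(Rd d, ℂ)) (x : Rd d) :
    ∫ t, ψ t * conv f φ (x - t) = conv f (schwartzConv ψ φ) x := by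
  obtain ⟨s, Λ, h⟩ := exists_eq_weightedDerivs f
  obtain ⟨hint, heq⟩ := weightedDerivs_reflectAt_schwartzConv s ψ φ x
  rw [conv, h, heq, ← Λ.integral_comp_comm hint]
  simp only [map_smul, smul_eq_mul, ← h]
  rfl

/-! ### The Fourier transform in terms of characters -/

theorem character_comm (a x : Rd d) : character a x = character x a := by
  rw [character, character, real_inner_comm]

theorem character_eq (a x : Rd d) :
    character a x = Complex.exp (((2 * Real.pi * inner ℝ a x : ℝ) : ℂ) * Complex.I) := by
  rw [character]
  congr 1
  push_cast
  ring

theorem norm_character (a x : Rd d) : ‖character a x‖ = 1 := by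
  rw [character_eq, Complex.norm_exp_ofReal_mul_I]

theorem character_add_right (a x y : Rd d) :
    character a (x + y) = character a x * character a y := by
  rw [character, character, character, ← Complex.exp_add, inner_add_right]
  congr 1
  push_cast
  ring

theorem character_neg_left (a x : Rd d) : character (-a) x = character a (-x) := by
  rw [character, character, inner_neg_left, inner_neg_right]

theorem character_add_left (a b x : Rd d) :
    character (a + b) x = character a x * character b x := by
  rw [character_comm, character_add_right, character_comm, character_comm x b]

theorem character_zero_left (x : Rd d) : character 0 x = 1 := by
  simp [character]

theorem continuous_character (a : Rd d) : Continuous (character a) := by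
  unfold character
  fun_prop

theorem fourier_eq_character (f : Rd d → ℂ) (w : Rd d) :
    𝓕 f w = ∫ v, character (-w) v * f v := by
  rw [Real.fourier_eq']
  congr 1 with v
  rw [character_eq, smul_eq_mul, inner_neg_left, real_inner_comm]
  congr 3
  push_cast
  ring

theorem fourierInv_eq_character (f : Rd d → ℂ) (w : Rd d) :
    𝓕⁻ f w = ∫ v, character w v * f v := by
  rw [Real.fourierInv_eq']
  congr 1 with v
  rw [character_eq, smul_eq_mul, real_inner_comm]

theorem integrable_character_mul (a : Rd d) {f : Rd d → ℂ} (hf : Integrable f) :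
    Integrable fun v => character a v * f v :=
  hf.bdd_mul (c := 1) (continuous_character a).aestronglyMeasurable
    (Filter.Eventually.of_forall fun v => (norm_character a v).le)

theorem fourier_character_mul (a : Rd d) (f : Rd d → ℂ) (w : Rd d) :
    𝓕 (fun v => character a v * f v) w = 𝓕 f (w - a) := by
  rw [fourier_eq_character, fourier_eq_character]
  congr 1 with v
  rw [neg_sub, sub_eq_add_neg, character_add_left]
  ring

theorem fourierInv_eq_fourier_character_mul (h : Rd d → ℂ) (x y : Rd d) :
    𝓕⁻ h (x - y) = 𝓕 (fun ξ => character x ξ * h ξ) y := by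
  rw [fourier_character_mul, Real.fourierInv_eq_fourier_neg, neg_sub]

theorem fourier_modulate (a : Rd d) (φ : 𝓢(Rd d, ℂ)) (ξ : Rd d) :
    𝓕 (modulate a φ) ξ = 𝓕 φ (ξ - a) := by
  rw [SchwartzMap.fourier_coe, SchwartzMap.fourier_coe, ← fourier_character_mul]
  exact congrArg (fun F : Rd d → ℂ => 𝓕 F ξ) (funext fun x => modulate_apply a φ x)

theorem integral_fourier_mul_eq_flip {f g : Rd d → ℂ} (hf : Integrable f) (hg : Integrable g) :
    ∫ ξ, 𝓕 f ξ * g ξ = ∫ x, f x * 𝓕 g x := by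
  have := VectorFourier.integral_bilin_fourierIntegral_eq_flip (μ := volume) (ν := volume)
    (L := innerₗ (Rd d)) (e := Real.fourierChar) (ContinuousLinearMap.mul ℂ ℂ)
    Real.continuous_fourierChar (by simpa using continuous_inner) hf hg
  rw [flip_innerₗ] at this
  exact this

theorem continuous_fourier {f : Rd d → ℂ} (hf : Integrable f) : Continuous (𝓕 f) :=
  VectorFourier.fourierIntegral_continuous Real.continuous_fourierChar
    (by simpa using continuous_inner) hf

theorem continuous_fourierInv {f : Rd d → ℂ} (hf : Integrable f) : Continuous (𝓕⁻ f) := by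
  have : 𝓕⁻ f = fun x => 𝓕 f (-x) := funext fun x => Real.fourierInv_eq_fourier_neg f x
  rw [this]
  exact (continuous_fourier hf).comp continuous_neg

theorem enorm_fourier_le (f : Rd d → ℂ) (x : Rd d) : ‖𝓕 f x‖ₑ ≤ ∫⁻ ξ, ‖f ξ‖ₑ := by
  rw [fourier_eq_character]
  refine (enorm_integral_le_lintegral_enorm _).trans_eq (lintegral_congr fun ξ => ?_)
  rw [enorm_mul, ← ofReal_norm, norm_character, ENNReal.ofReal_one, one_mul]

theorem enorm_fourierInv_le (f : Rd d → ℂ) (x : Rd d) : ‖𝓕⁻ f x‖ₑ ≤ ∫⁻ ξ, ‖f ξ‖ₑ := by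
  rw [Real.fourierInv_eq_fourier_neg]
  exact enorm_fourier_le f _

/-! ### Plancherel–Polya–Nikolskii inequalities for exponents below one -/

theorem eq_rpow_mul_rpow_one_sub {P : ℝ} (hP : 0 < P) (hP1 : P ≤ 1) (v : ℝ≥0∞) :
    v = v ^ P * v ^ (1 - P) := by
  rw [← ENNReal.rpow_add_of_nonneg _ _ hP.le (by linarith)]
  simp

theorem one_add_enorm_pow_le_mul (x y z : Rd d) (N : ℕ) :
    (1 + ‖y - z‖ₑ) ^ N ≤ (1 + ‖x - z‖ₑ) ^ N * (1 + ‖x - y‖ₑ) ^ N := by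
  rw [← mul_pow]
  gcongr
  have : ‖y - z‖ₑ ≤ ‖x - z‖ₑ + ‖x - y‖ₑ := by
    calc ‖y - z‖ₑ = ‖(x - z) - (x - y)‖ₑ := by congr 1; abel
      _ ≤ _ := enorm_sub_le
  calc 1 + ‖y - z‖ₑ ≤ 1 + (‖x - z‖ₑ + ‖x - y‖ₑ) := by gcongr
    _ ≤ 1 + (‖x - z‖ₑ + ‖x - y‖ₑ) + ‖x - z‖ₑ * ‖x - y‖ₑ := le_self_add
    _ = _ := by ring

/-- Splitting v = v^P v^{1-P} inside the convolution and bounding v^{1-P} by a weighted supremum M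
gives M ≤ M^{1-P} A ∫ v^P. Since M is finite, M^{1-P} cancels. -/
theorem rpow_le_mul_lintegral_of_le_convolution {P : ℝ} (hP : 0 < P) (hP1 : P ≤ 1)
    {v k : Rd d → ℝ≥0∞} {A C : ℝ≥0∞} (N : ℕ) (hA : A ≠ ∞) (hC : C ≠ ∞)
    (hk : ∀ z, (1 + ‖z‖ₑ) ^ N * k z ≤ A) (hv : ∀ x, v x ≤ C * (1 + ‖x‖ₑ) ^ N)
    (hrep : ∀ x, v x ≤ ∫⁻ y, v y * k (x - y)) (x₀ : Rd d) :
    v x₀ ^ P ≤ A * ∫⁻ y, v y ^ P := by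
  -- The weight is centred at x₀, where it equals 1, so v x₀ ≤ M and the final constant does not
  -- depend on x₀. Polynomial growth of v makes M finite.
  set w : Rd d → ℝ≥0∞ := fun y => (1 + ‖y - x₀‖ₑ) ^ N with hw
  have hw1 : ∀ y, 1 ≤ w y := fun y => one_le_pow₀ le_self_add
  have hwtop : ∀ y, w y ≠ ∞ := fun y => ENNReal.pow_ne_top (by simp)
  have hw0 : ∀ y, w y ≠ 0 := fun y => (zero_lt_one.trans_le (hw1 y)).ne'
  set M := ⨆ y, v y / w y with hM
  have hvM : ∀ y, v y ≤ M * w y := fun y =>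
    (ENNReal.div_le_iff (hw0 y) (hwtop y)).1 (le_iSup (fun y => v y / w y) y)
  have hvM0 : v x₀ ≤ M := by simpa [hw] using hvM x₀
  have hMtop : M ≠ ∞ := by
    refine ne_top_of_le_ne_top (b := C * (1 + ‖x₀‖ₑ) ^ N)
      (ENNReal.mul_ne_top hC (ENNReal.pow_ne_top (by simp))) (iSup_le fun y => ?_)
    rw [ENNReal.div_le_iff (hw0 y) (hwtop y)]
    refine (hv y).trans ?_
    rw [mul_assoc]
    gcongr
    have := one_add_enorm_pow_le_mul x₀ y 0 N
    simpa [hw, enorm_sub_rev] using this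
  rcases eq_or_ne M 0 with hM0 | hM0
  · have : v x₀ = 0 := le_antisymm (hM0 ▸ hvM0) bot_le
    rw [this, ENNReal.zero_rpow_of_pos hP]
    exact bot_le
  have hM1top : M ^ (1 - P) ≠ ∞ := ENNReal.rpow_ne_top_of_nonneg (by linarith) hMtop
  have hM10 : M ^ (1 - P) ≠ 0 := (ENNReal.rpow_pos (pos_iff_ne_zero.2 hM0) hMtop).ne'
  have key : M ≤ M ^ (1 - P) * (A * ∫⁻ y, v y ^ P) := by
    refine iSup_le fun x => ?_
    rw [ENNReal.div_le_iff (hw0 x) (hwtop x)]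
    calc v x ≤ ∫⁻ y, v y * k (x - y) := hrep x
      _ ≤ ∫⁻ y, (M ^ (1 - P) * A * w x) * v y ^ P := by
          refine lintegral_mono fun y => ?_
          calc v y * k (x - y) = v y ^ P * v y ^ (1 - P) * k (x - y) := by
                rw [← eq_rpow_mul_rpow_one_sub hP hP1]
            _ ≤ v y ^ P * (M ^ (1 - P) * w y) * k (x - y) := by
                gcongr
                calc v y ^ (1 - P) ≤ (M * w y) ^ (1 - P) :=
                      ENNReal.rpow_le_rpow (hvM y) (by linarith)
                  _ = M ^ (1 - P) * w y ^ (1 - P) := ENNReal.mul_rpow_of_nonneg _ _ (by linarith)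
                  _ ≤ M ^ (1 - P) * w y := by
                      gcongr
                      calc w y ^ (1 - P) ≤ w y ^ (1 : ℝ) :=
                            ENNReal.rpow_le_rpow_of_exponent_le (hw1 y) (by linarith)
                        _ = w y := ENNReal.rpow_one _
            _ ≤ v y ^ P * (M ^ (1 - P) * (w x * (1 + ‖x - y‖ₑ) ^ N)) * k (x - y) := by
                gcongr
                exact one_add_enorm_pow_le_mul x y x₀ N
            _ = M ^ (1 - P) * ((1 + ‖x - y‖ₑ) ^ N * k (x - y)) * w x * v y ^ P := by ring
            _ ≤ _ := by gcongr; exact hk _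
      _ = _ := by
          rw [lintegral_const_mul' _ _ (ENNReal.mul_ne_top (ENNReal.mul_ne_top hM1top hA)
            (hwtop x))]
          ring
  refine (ENNReal.rpow_le_rpow hvM0 hP.le).trans ?_
  rw [← ENNReal.mul_le_mul_iff_right hM10 hM1top]
  calc M ^ (1 - P) * M ^ P = M := by
        rw [mul_comm, ← eq_rpow_mul_rpow_one_sub hP hP1]
    _ ≤ _ := key

/-- Bound the factor v^{1-P} in v = v^P v^{1-P} by the assumed supremum estimate and integrate. -/
theorem lintegral_rpow_le_mul_lintegral_rpow {P : ℝ} (hP : 0 < P) (hP1 : P ≤ 1)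
    {v : Rd d → ℝ≥0∞} {A : ℝ≥0∞} (hA : A ≠ ∞) (hA0 : A ≠ 0)
    (hv : ∀ x, v x ^ P ≤ A * ∫⁻ y, v y ^ P) :
    (∫⁻ y, v y) ^ P ≤ A ^ (1 - P) * ∫⁻ y, v y ^ P := by
  set I := ∫⁻ y, v y ^ P with hI
  have hAP0 : A ^ (1 - P) ≠ 0 := (ENNReal.rpow_pos (pos_iff_ne_zero.2 hA0) hA).ne'
  rcases eq_or_ne I ∞ with h | h
  · rw [h, ENNReal.mul_top hAP0]
    exact le_top
  have hAI : A * I ≠ ∞ := ENNReal.mul_ne_top hA h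
  have hq : 0 ≤ (1 - P) / P := div_nonneg (by linarith) hP.le
  have h1 : ∫⁻ y, v y ≤ (A * I) ^ ((1 - P) / P) * I := by
    rw [hI, ← lintegral_const_mul' _ _ (ENNReal.rpow_ne_top_of_nonneg hq hAI)]
    refine lintegral_mono fun y => ?_
    calc v y = v y ^ P * v y ^ (1 - P) := eq_rpow_mul_rpow_one_sub hP hP1 _
      _ = (v y ^ P) ^ ((1 - P) / P) * v y ^ P := by
          rw [← ENNReal.rpow_mul, mul_div_cancel₀ _ hP.ne', mul_comm]
      _ ≤ _ := by gcongr; exact hv y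
  calc (∫⁻ y, v y) ^ P ≤ ((A * I) ^ ((1 - P) / P) * I) ^ P := ENNReal.rpow_le_rpow h1 hP.le
    _ = (A * I) ^ (1 - P) * I ^ P := by
        rw [ENNReal.mul_rpow_of_nonneg _ _ hP.le, ← ENNReal.rpow_mul, div_mul_cancel₀ _ hP.ne']
    _ = A ^ (1 - P) * (I ^ P * I ^ (1 - P)) := by
        rw [ENNReal.mul_rpow_of_nonneg _ _ (by linarith : (0 : ℝ) ≤ 1 - P)]
        ring
    _ = _ := by rw [← eq_rpow_mul_rpow_one_sub hP hP1]

/-! ### Band-limited functions -/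

/-- Radius 2 rather than 1 because the kernel must also reproduce a product of two functions, each
with spectrum in a unit ball. -/
theorem exists_fourier_eq_one_on_ball (d : ℕ) :
    ∃ Ψ : 𝓢(Rd d, ℂ), ∀ ξ : Rd d, ‖ξ‖ ≤ 2 → 𝓕 Ψ ξ = 1 := by
  let b : ContDiffBump (0 : Rd d) := ⟨2, 3, by norm_num, by norm_num⟩
  have hb : HasCompactSupport fun ξ : Rd d => ((b ξ : ℝ) : ℂ) :=
    b.hasCompactSupport.comp_left (g := fun t : ℝ => (t : ℂ)) Complex.ofReal_zero
  have hb' : ContDiff ℝ ((⊤ : ℕ∞) : WithTop ℕ∞) fun ξ : Rd d => ((b ξ : ℝ) : ℂ) :=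
    Complex.ofRealCLM.contDiff.comp b.contDiff
  refine ⟨𝓕⁻ (hb.toSchwartzMap hb'), fun ξ hξ => ?_⟩
  rw [FourierTransform.fourier_fourierInv_eq]
  change ((b ξ : ℝ) : ℂ) = 1
  rw [b.one_of_mem_closedBall (by simpa [b] using hξ), Complex.ofReal_one]

/-- A Schwartz function whose Fourier transform is one on the ball of radius two. -/
def plateau (d : ℕ) : 𝓢(Rd d, ℂ) := (exists_fourier_eq_one_on_ball d).choose

theorem fourier_plateau {ξ : Rd d} (hξ : ‖ξ‖ ≤ 2) : 𝓕 (plateau d) ξ = 1 :=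
  (exists_fourier_eq_one_on_ball d).choose_spec ξ hξ

theorem exists_enorm_plateau_le (d N : ℕ) :
    ∃ A : ℝ≥0∞, A ≠ ∞ ∧ A ≠ 0 ∧ ∀ z : Rd d, (1 + ‖z‖ₑ) ^ N * ‖plateau d z‖ₑ ≤ A := by
  obtain ⟨C, hC, h⟩ := exists_bound_one_add_norm_pow_mul (plateau d) N 0
  -- The added 1 keeps the bound nonzero, so that its product with an infinite integral is infinite.
  refine ⟨ENNReal.ofReal C + 1, by simp, by simp, fun z => le_trans ?_ le_self_add⟩
  have h1 : (1 + ‖z‖ₑ) ^ N * ‖plateau d z‖ₑ =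
      ENNReal.ofReal ((1 + ‖z‖) ^ N * ‖iteratedFDeriv ℝ 0 (plateau d) z‖) := by
    rw [norm_iteratedFDeriv_zero, ENNReal.ofReal_mul (by positivity),
      ENNReal.ofReal_pow (by positivity), ENNReal.ofReal_add zero_le_one (norm_nonneg _),
      ofReal_norm, ofReal_norm, ENNReal.ofReal_one]
  rw [h1]
  exact ENNReal.ofReal_le_ofReal (h z)

theorem enorm_modulate (a : Rd d) (φ : 𝓢(Rd d, ℂ)) (x : Rd d) : ‖modulate a φ x‖ₑ = ‖φ x‖ₑ := by
  rw [modulate_apply, enorm_mul, ← ofReal_norm, norm_character, ENNReal.ofReal_one, one_mul]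

/-- A bound for the supremum of `plateau d`. -/
def plateauBound (d : ℕ) : ℝ≥0∞ := (exists_enorm_plateau_le d 0).choose

theorem plateauBound_ne_top (d : ℕ) : plateauBound d ≠ ∞ :=
  (exists_enorm_plateau_le d 0).choose_spec.1

theorem plateauBound_ne_zero (d : ℕ) : plateauBound d ≠ 0 :=
  (exists_enorm_plateau_le d 0).choose_spec.2.1

theorem enorm_plateau_le (z : Rd d) : ‖plateau d z‖ₑ ≤ plateauBound d := by
  have := (exists_enorm_plateau_le d 0).choose_spec.2.2 z
  rwa [pow_zero, one_mul] at this

/-- A function that is reproduced by convolution with a modulation of `plateau d`, as are the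
functions with spectrum in the ball of radius two about `a`. -/
def Reproduced (a : Rd d) (u : Rd d → ℂ) : Prop :=
  ∀ x, u x = ∫ t, modulate a (plateau d) t * u (x - t)

/-- The modulation disappears in absolute value, so later constants do not depend on the centre a.
-/
theorem Reproduced.enorm_le {a : Rd d} {u : Rd d → ℂ} (hu : Reproduced a u) (x : Rd d) :
    ‖u x‖ₑ ≤ ∫⁻ y, ‖u y‖ₑ * ‖plateau d (x - y)‖ₑ := by
  calc ‖u x‖ₑ = ‖∫ t, modulate a (plateau d) t * u (x - t)‖ₑ := by rw [← hu x]
    _ ≤ ∫⁻ t, ‖modulate a (plateau d) t * u (x - t)‖ₑ := enorm_integral_le_lintegral_enorm _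
    _ = ∫⁻ y, ‖modulate a (plateau d) (x - y) * u (x - (x - y))‖ₑ :=
        (lintegral_sub_left_eq_self
          (fun t => ‖modulate a (plateau d) t * u (x - t)‖ₑ) x).symm
    _ = _ := by
        refine lintegral_congr fun y => ?_
        rw [enorm_mul, enorm_modulate, sub_sub_cancel, mul_comm]

theorem Reproduced.enorm_rpow_le_of_bounded {a : Rd d} {u : Rd d → ℂ} (hu : Reproduced a u)
    {P : ℝ} (hP : 0 < P) (hP1 : P ≤ 1) {C : ℝ≥0∞} (hC : C ≠ ∞) (hb : ∀ x, ‖u x‖ₑ ≤ C)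
    (x : Rd d) : ‖u x‖ₑ ^ P ≤ plateauBound d * ∫⁻ y, ‖u y‖ₑ ^ P :=
  rpow_le_mul_lintegral_of_le_convolution hP hP1 (v := fun x => ‖u x‖ₑ)
    (k := fun x => ‖plateau d x‖ₑ) 0 (plateauBound_ne_top d) hC
    (fun z => by simpa using enorm_plateau_le z) (fun x => by simpa using hb x) hu.enorm_le x

/-- Nikolskii's inequality for functions of polynomial growth. -/
theorem Reproduced.enorm_rpow_le {a : Rd d} {u : Rd d → ℂ} (hu : Reproduced a u)
    {P : ℝ} (hP : 0 < P) (hP1 : P ≤ 1) {C : ℝ≥0∞} (hC : C ≠ ∞) (N : ℕ)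
    (hb : ∀ x, ‖u x‖ₑ ≤ C * (1 + ‖x‖ₑ) ^ N)
    (x : Rd d) : ‖u x‖ₑ ^ P ≤ plateauBound d * ∫⁻ y, ‖u y‖ₑ ^ P := by
  rcases eq_or_ne (∫⁻ y, ‖u y‖ₑ ^ P) ∞ with h | h
  · rw [h, ENNReal.mul_top (plateauBound_ne_zero d)]
    exact le_top
  obtain ⟨A, hA, -, hA'⟩ := exists_enorm_plateau_le d N
  -- The argument runs twice. With exponent N it gives only boundedness, with a constant depending
  -- on N; rerun with exponent 0 on the now bounded u, it gives the universal constant.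
  have h1 := rpow_le_mul_lintegral_of_le_convolution hP hP1 (v := fun x => ‖u x‖ₑ)
    (k := fun x => ‖plateau d x‖ₑ) N hA hC hA' hb hu.enorm_le
  refine hu.enorm_rpow_le_of_bounded hP hP1 (C := (A * ∫⁻ y, ‖u y‖ₑ ^ P) ^ P⁻¹)
    (ENNReal.rpow_ne_top_of_nonneg (by positivity) (ENNReal.mul_ne_top hA h)) (fun y => ?_) x
  exact (ENNReal.le_rpow_inv_iff hP).2 (h1 y)

/-- By the multiplication formula the convolution becomes the inverse transform of h times the
transform of the modulated plateau, which is 1 wherever h does not vanish. -/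
theorem reproduced_fourierInv {h : Rd d → ℂ} (hh : Integrable h) {a : Rd d}
    (ha : ∀ ξ, 2 < ‖ξ - a‖ → h ξ = 0) : Reproduced a (𝓕⁻ h) := by
  intro x
  have h1 : ∀ t, 𝓕⁻ h (x - t) = 𝓕 (fun ξ => character x ξ * h ξ) t :=
    fun t => fourierInv_eq_fourier_character_mul h x t
  simp only [h1]
  rw [← integral_fourier_mul_eq_flip (modulate a (plateau d)).integrable
    (integrable_character_mul x hh), fourierInv_eq_character]
  congr 1 with ξ
  rw [← SchwartzMap.fourier_coe, fourier_modulate]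
  by_cases hξ : 2 < ‖ξ - a‖
  · rw [ha ξ hξ]; simp
  · rw [fourier_plateau (not_lt.1 hξ), one_mul]

theorem fourier_fourierInv_mul (h g : Rd d → ℂ) (hh : Integrable h) (hg : Integrable g)
    (x ζ : Rd d) :
    𝓕 (fun y => 𝓕⁻ h (x - y) * g y) ζ = ∫ ξ, character x ξ * h ξ * 𝓕 g (ξ + ζ) := by
  have h1 : ∀ ξ, 𝓕 g (ξ + ζ) = 𝓕 (fun y => character (-ζ) y * g y) ξ := fun ξ => by
    rw [fourier_character_mul, sub_neg_eq_add]
  simp only [h1]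
  rw [← integral_fourier_mul_eq_flip (integrable_character_mul x hh)
    (integrable_character_mul (-ζ) hg), fourier_eq_character]
  congr 1 with y
  rw [fourierInv_eq_fourier_character_mul]
  ring

theorem fourierInv_mul_fourier (h g : Rd d → ℂ) (hh : Integrable h) (hg : Integrable g)
    (x : Rd d) :
    𝓕⁻ (fun ξ => h ξ * 𝓕 g ξ) x = ∫ y, 𝓕⁻ h (x - y) * g y := by
  have := fourier_fourierInv_mul h g hh hg x 0
  rw [fourier_eq_character] at this
  simp only [neg_zero, character_zero_left, one_mul, add_zero] at this
  rw [this, fourierInv_eq_character]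
  simp only [mul_assoc]

/-- Reflecting 𝓕⁻ h moves its spectrum to the unit ball about -b, and multiplying by g adds the unit
ball about c. The product is continuous and integrable with a compactly supported transform, so
Fourier inversion applies. -/
theorem Reproduced.product {h g : Rd d → ℂ} (hh : Integrable h) (hg : Integrable g)
    (hgc : Continuous g) {b c : Rd d} (hb : ∀ ξ, 1 < ‖ξ - b‖ → h ξ = 0)
    (hc : ∀ ξ, 1 < ‖ξ - c‖ → 𝓕 g ξ = 0) (x : Rd d) :
    Reproduced (c - b) (fun y => 𝓕⁻ h (x - y) * g y) := by
  set w : Rd d → ℂ := fun y => 𝓕⁻ h (x - y) * g y with hw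
  have hKc : Continuous fun y => 𝓕⁻ h (x - y) :=
    (continuous_fourierInv hh).comp (continuous_const.sub continuous_id)
  have hwc : Continuous w := hKc.mul hgc
  have hwi : Integrable w := by
    refine hg.bdd_mul (c := (∫⁻ ξ, ‖h ξ‖ₑ).toReal) hKc.aestronglyMeasurable
      (Filter.Eventually.of_forall fun y => ?_)
    rw [← toReal_enorm]
    exact ENNReal.toReal_mono hh.2.ne (enorm_fourierInv_le h _)
  have hsupp : ∀ ζ, 2 < ‖ζ - (c - b)‖ → 𝓕 w ζ = 0 := by
    intro ζ hζ
    rw [hw, fourier_fourierInv_mul h g hh hg]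
    refine integral_eq_zero_of_ae (Filter.Eventually.of_forall fun ξ => ?_)
    by_cases h1 : 1 < ‖ξ - b‖
    · simp [hb ξ h1]
    · have h2 : 1 < ‖ξ + ζ - c‖ := by
        have : ‖ζ - (c - b)‖ ≤ ‖ξ + ζ - c‖ + ‖ξ - b‖ := by
          calc ‖ζ - (c - b)‖ = ‖(ξ + ζ - c) - (ξ - b)‖ := by congr 1; abel
            _ ≤ _ := norm_sub_le _ _
        linarith [not_lt.1 h1]
      simp [hc _ h2]
  have hwF : Integrable (𝓕 w) := by
    refine (continuous_fourier hwi).integrable_of_hasCompactSupport ?_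
    refine HasCompactSupport.of_support_subset_isCompact (isCompact_closedBall (c - b) 2) ?_
    intro ζ hζ
    rw [Metric.mem_closedBall, dist_eq_norm]
    by_contra hcon
    exact hζ (hsupp ζ (not_le.1 hcon))
  have : w = 𝓕⁻ (𝓕 w) := (hwc.fourierInv_fourier_eq hwi hwF).symm
  rw [this]
  exact reproduced_fourierInv hwF hsupp

/-- Convolution estimate in `L^P`, `P ≤ 1`, for band-limited functions. -/
theorem lintegral_fourierInv_mul_fourier_rpow_le {P : ℝ} (hP : 0 < P) (hP1 : P ≤ 1)
    {h g : Rd d → ℂ} (hh : Integrable h) (hg : Integrable g)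
    (hgc : Continuous g) {M : ℝ≥0∞} (hM : M ≠ ∞) (hgM : ∀ y, ‖g y‖ₑ ≤ M)
    {b c : Rd d} (hb : ∀ ξ, 1 < ‖ξ - b‖ → h ξ = 0)
    (hc : ∀ ξ, 1 < ‖ξ - c‖ → 𝓕 g ξ = 0) :
    ∫⁻ x, ‖𝓕⁻ (fun ξ => h ξ * 𝓕 g ξ) x‖ₑ ^ P ≤
      plateauBound d ^ (1 - P) * ((∫⁻ x, ‖𝓕⁻ h x‖ₑ ^ P) * ∫⁻ x, ‖g x‖ₑ ^ P) := by
  have hK := continuous_fourierInv hh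
  have hA : plateauBound d ^ (1 - P) ≠ ∞ :=
    ENNReal.rpow_ne_top_of_nonneg (by linarith) (plateauBound_ne_top d)
  -- For each fixed x, the L^1 norm of y ↦ 𝓕⁻ h (x - y) g(y) is bounded by its L^P quasi-norm, with
  -- a constant independent of x.
  have h1 : ∀ x, ‖𝓕⁻ (fun ξ => h ξ * 𝓕 g ξ) x‖ₑ ^ P ≤
      plateauBound d ^ (1 - P) * ∫⁻ y, ‖𝓕⁻ h (x - y)‖ₑ ^ P * ‖g y‖ₑ ^ P := by
    intro x
    rw [fourierInv_mul_fourier h g hh hg]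
    refine (ENNReal.rpow_le_rpow (enorm_integral_le_lintegral_enorm _) hP.le).trans ?_
    have hb' : ∀ y, ‖𝓕⁻ h (x - y) * g y‖ₑ ≤ (∫⁻ ξ, ‖h ξ‖ₑ) * M := fun y => by
      rw [enorm_mul]
      gcongr
      · exact enorm_fourierInv_le h _
      · exact hgM y
    have := lintegral_rpow_le_mul_lintegral_rpow hP hP1 (plateauBound_ne_top d)
      (plateauBound_ne_zero d) ((Reproduced.product hh hg hgc hb hc x).enorm_rpow_le_of_bounded
        hP hP1 (ENNReal.mul_ne_top hh.2.ne hM) hb')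
    simpa only [enorm_mul, ENNReal.mul_rpow_of_nonneg _ _ hP.le] using this
  calc _ ≤ ∫⁻ x, plateauBound d ^ (1 - P) * ∫⁻ y, ‖𝓕⁻ h (x - y)‖ₑ ^ P * ‖g y‖ₑ ^ P :=
        lintegral_mono h1
    _ = plateauBound d ^ (1 - P) * ∫⁻ x, ∫⁻ y, ‖𝓕⁻ h (x - y)‖ₑ ^ P * ‖g y‖ₑ ^ P :=
        lintegral_const_mul' _ _ hA
    _ = plateauBound d ^ (1 - P) * ∫⁻ y, ∫⁻ x, ‖𝓕⁻ h (x - y)‖ₑ ^ P * ‖g y‖ₑ ^ P := by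
        rw [lintegral_lintegral_swap]
        refine Measurable.aemeasurable ?_
        have := hK.measurable
        have := hgc.measurable
        simp only [Function.uncurry_def]
        fun_prop
    _ = _ := by
        congr 1
        rw [← lintegral_const_mul _ (hgc.measurable.enorm.pow_const P)]
        refine lintegral_congr fun y => ?_
        have hKm : Measurable fun x => ‖𝓕⁻ h (x - y)‖ₑ ^ P :=
          (hK.measurable.comp (measurable_id.sub_const y)).enorm.pow_const P
        rw [lintegral_mul_const _ hKm,
          lintegral_sub_right_eq_self (fun x => ‖𝓕⁻ h x‖ₑ ^ P) y]

/-! ### Lattice points in balls -/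

theorem latticePoint_apply (β : ℝ) (k : Fin d → ℤ) (i : Fin d) :
    latticePoint β k i = β * k i := by
  simp [latticePoint]

/-- A finite set of indices containing those of the lattice points at distance at most `R`
from `ξ`. -/
def latticeNear (β R : ℝ) (ξ : Rd d) : Finset (Fin d → ℤ) :=
  Fintype.piFinset fun i => Finset.Icc ⌈(ξ i - R) / β⌉ ⌊(ξ i + R) / β⌋

theorem mem_latticeNear {β R : ℝ} (hβ : 0 < β) {ξ : Rd d} {k : Fin d → ℤ}
    (h : ‖ξ - latticePoint β k‖ ≤ R) : k ∈ latticeNear β R ξ := by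
  refine Fintype.mem_piFinset.2 fun i => ?_
  have h1 : |ξ i - β * k i| ≤ R := by
    have := (PiLp.norm_apply_le (ξ - latticePoint β k) i).trans h
    rwa [PiLp.sub_apply, latticePoint_apply, Real.norm_eq_abs] at this
  rw [abs_le] at h1
  rw [Finset.mem_Icc, Int.ceil_le, Int.le_floor, div_le_iff₀ hβ, le_div_iff₀ hβ]
  constructor <;> linarith

/-- A bound for the number of lattice points in a ball of radius `R`. -/
def latticeCount (d : ℕ) (β R : ℝ) : ℕ := (⌊2 * R / β⌋ + 1).toNat ^ d

theorem card_latticeNear_le (β R : ℝ) (ξ : Rd d) :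
    (latticeNear β R ξ).card ≤ latticeCount d β R := by
  rw [latticeNear, Fintype.card_piFinset, latticeCount]
  refine (Finset.prod_le_pow_card _ _ (⌊2 * R / β⌋ + 1).toNat fun i _ => ?_).trans (by simp)
  rw [Int.card_Icc]
  refine Int.toNat_le_toNat ?_
  have h : ⌊(ξ i + R) / β⌋ - ⌈(ξ i - R) / β⌉ ≤ ⌊2 * R / β⌋ := by
    rw [Int.le_floor]
    push_cast
    have h1 := Int.floor_le ((ξ i + R) / β)
    have h2 := Int.le_ceil ((ξ i - R) / β)
    have h3 : 2 * R / β = (ξ i + R) / β - (ξ i - R) / β := by ring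
    linarith
  linarith

theorem IsUniformDecomposition.sum_eq_one {β : ℝ} {χ : 𝓢(Rd d, ℂ)}
    (h : IsUniformDecomposition β χ) {ξ : Rd d} {S : Finset (Fin d → ℤ)}
    (hS : ∀ k, ‖ξ - latticePoint β k‖ ≤ 1 → k ∈ S) :
    ∑ k ∈ S, 𝓕 χ (ξ - latticePoint β k) = 1 := by
  refine HasSum.unique (hasSum_sum_of_ne_finset_zero fun k hk => ?_) (h.hasSum_one ξ)
  by_contra hne
  refine hk (hS k (not_lt.1 fun hlt => hne (h.support_subset _ hlt)))

/-! ### Symbols in the Wiener amalgam space -/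

/-- Fourier inversion without continuity of h: test against smooth compactly supported g = 𝓕 G with
G Schwartz, and move transforms across by the multiplication formula. -/
theorem ae_eq_fourier_of_integrable_fourierInv {h : Rd d → ℂ} (hh : Integrable h)
    (hK : Integrable (𝓕⁻ h)) : ∀ᵐ ξ, h ξ = 𝓕 (𝓕⁻ h) ξ := by
  refine ae_eq_of_integral_contDiff_smul_eq hh.locallyIntegrable
    (continuous_fourier hK).locallyIntegrable fun g hg hgs => ?_
  have hb : HasCompactSupport fun ξ : Rd d => ((g ξ : ℝ) : ℂ) :=
    hgs.comp_left (g := fun t : ℝ => (t : ℂ)) Complex.ofReal_zero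
  have hb' : ContDiff ℝ ((⊤ : ℕ∞) : WithTop ℕ∞) fun ξ : Rd d => ((g ξ : ℝ) : ℂ) :=
    Complex.ofRealCLM.contDiff.comp hg
  set G : 𝓢(Rd d, ℂ) := 𝓕⁻ (hb.toSchwartzMap hb') with hG
  have hgG : ∀ ξ, ((g ξ : ℝ) : ℂ) = 𝓕 (G : Rd d → ℂ) ξ := fun ξ => by
    rw [← SchwartzMap.fourier_coe, hG, FourierTransform.fourier_fourierInv_eq]
    rfl
  have hh' : ∀ y, 𝓕 h y = 𝓕⁻ h (-y) := fun y => by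
    rw [Real.fourierInv_eq_fourier_neg, neg_neg]
  simp only [Complex.real_smul]
  calc ∫ ξ, ((g ξ : ℝ) : ℂ) * h ξ = ∫ y, G y * 𝓕 h y := by
        simp only [hgG]
        exact integral_fourier_mul_eq_flip G.integrable hh
    _ = ∫ y, G (-y) * 𝓕⁻ h y := by
        rw [← integral_neg_eq_self]
        simp only [hh', neg_neg]
    _ = ∫ y, 𝓕 (𝓕 (G : Rd d → ℂ)) y * 𝓕⁻ h y := by
        congr 1 with y
        have h1 : 𝓕 (𝓕 (G : Rd d → ℂ)) y = 𝓕⁻ (𝓕 (G : Rd d → ℂ)) (-y) := by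
          rw [Real.fourierInv_eq_fourier_neg, neg_neg]
        rw [h1, ← SchwartzMap.fourier_coe, ← SchwartzMap.fourierInv_coe,
          FourierTransform.fourierInv_fourier_eq]
    _ = ∫ ξ, 𝓕 (G : Rd d → ℂ) ξ * 𝓕 (𝓕⁻ h) ξ := by
        rw [← SchwartzMap.fourier_coe]
        exact integral_fourier_mul_eq_flip (𝓕 G).integrable hK
    _ = _ := by simp only [hgG]

section Wiener

variable {p : ℝ≥0∞} {β : ℝ} {χ : 𝓢(Rd d, ℂ)} {σ : Rd d → ℂ}

/-- The localization `σ · T_{β n} χ̂` of a symbol. -/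
def localized (σ : Rd d → ℂ) (β : ℝ) (χ : 𝓢(Rd d, ℂ)) (n : Fin d → ℤ) (ξ : Rd d) : ℂ :=
  σ ξ * 𝓕 χ (ξ - latticePoint β n)

theorem localized_eq_zero (hχ : IsUniformDecomposition β χ) (n : Fin d → ℤ) {ξ : Rd d}
    (hξ : 1 < ‖ξ - latticePoint β n‖) : localized σ β χ n ξ = 0 := by
  rw [localized, hχ.support_subset _ hξ, mul_zero]

theorem integrable_localized (hχ : IsUniformDecomposition β χ) (hσ : LocallyIntegrable σ)
    (n : Fin d → ℤ) : Integrable (localized σ β χ n) := by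
  have hc : Continuous fun ξ => 𝓕 χ (ξ - latticePoint β n) :=
    (𝓕 χ).continuous.comp (continuous_id.sub continuous_const)
  have hs : HasCompactSupport fun ξ => 𝓕 χ (ξ - latticePoint β n) := by
    refine HasCompactSupport.of_support_subset_isCompact
      (isCompact_closedBall (latticePoint β n) 1) fun ξ hξ => ?_
    rw [Metric.mem_closedBall, dist_eq_norm]
    by_contra hcon
    exact hξ (hχ.support_subset _ (not_le.1 hcon))
  exact hσ.integrable_smul_right_of_hasCompactSupport hc hs

theorem lintegral_enorm_rpow_eq (hp : 0 < p) (hp1 : p < 1) (u : Rd d → ℂ) :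
    ∫⁻ x, ‖u x‖ₑ ^ p.toReal = eLpNorm u p volume ^ p.toReal := by
  have hp' := ENNReal.toReal_pos hp.ne' (hp1.trans ENNReal.one_lt_top).ne
  rw [eLpNorm_eq_lintegral_rpow_enorm_toReal hp.ne' (hp1.trans ENNReal.one_lt_top).ne,
    ← ENNReal.rpow_mul, one_div, inv_mul_cancel₀ hp'.ne', ENNReal.rpow_one]

theorem lintegral_localized_le (hp : 0 < p) (hp1 : p < 1) (n : Fin d → ℤ) :
    ∫⁻ x, ‖𝓕⁻ (localized σ β χ n) x‖ₑ ^ p.toReal ≤ wienerNorm p β χ σ ^ p.toReal := by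
  rw [lintegral_enorm_rpow_eq hp hp1]
  exact ENNReal.rpow_le_rpow
    (le_iSup (fun n => fourierLpNorm p (localized σ β χ n)) n) ENNReal.toReal_nonneg

theorem toReal_mem_Ioo (hp : 0 < p) (hp1 : p < 1) : 0 < p.toReal ∧ p.toReal ≤ 1 := by
  refine ⟨ENNReal.toReal_pos hp.ne' (hp1.trans ENNReal.one_lt_top).ne, ?_⟩
  have := ENNReal.toReal_mono ENNReal.one_ne_top hp1.le
  simpa using this

/-- Functions in the Wiener amalgam space are essentially bounded. -/
theorem MemWiener.exists_ae_bound (hχ : IsUniformDecomposition β χ) (hp : 0 < p) (hp1 : p < 1)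
    (hσ : MemWiener p β χ σ) : ∃ D : ℝ, 0 ≤ D ∧ ∀ᵐ ξ, ‖σ ξ‖ ≤ D := by
  obtain ⟨hP, hP1⟩ := toReal_mem_Ioo hp hp1
  set P := p.toReal
  set W := (plateauBound d ^ (1 - P) * wienerNorm p β χ σ ^ P) ^ P⁻¹ with hW
  have hWtop : W ≠ ∞ := ENNReal.rpow_ne_top_of_nonneg (by positivity) (ENNReal.mul_ne_top
    (ENNReal.rpow_ne_top_of_nonneg (by linarith) (plateauBound_ne_top d))
    (ENNReal.rpow_ne_top_of_nonneg hP.le hσ.2.ne))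
  have hint := integrable_localized hχ hσ.1
  -- Nikolskii upgrades the uniform L^p bound to a uniform L^1 bound; inversion then bounds each
  -- localization, and at most `latticeCount d β 1` of them meet at a point.
  have hL1 : ∀ n, ∫⁻ x, ‖𝓕⁻ (localized σ β χ n) x‖ₑ ≤ W := fun n => by
    have hrep := reproduced_fourierInv (hint n) (a := latticePoint β n)
      fun ξ hξ => localized_eq_zero hχ n (by linarith)
    have h1 := lintegral_rpow_le_mul_lintegral_rpow hP hP1 (plateauBound_ne_top d)
      (plateauBound_ne_zero d) (hrep.enorm_rpow_le_of_bounded hP hP1 (hint n).2.ne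
        (enorm_fourierInv_le _))
    rw [hW, ENNReal.le_rpow_inv_iff hP]
    refine h1.trans ?_
    gcongr
    exact lintegral_localized_le hp hp1 n
  have hbound : ∀ᵐ ξ, ∀ n, ‖localized σ β χ n ξ‖ ≤ W.toReal := by
    rw [ae_all_iff]
    intro n
    have hK : Integrable (𝓕⁻ (localized σ β χ n)) :=
      ⟨(continuous_fourierInv (hint n)).aestronglyMeasurable, (hL1 n).trans_lt hWtop.lt_top⟩
    filter_upwards [ae_eq_fourier_of_integrable_fourierInv (hint n) hK] with ξ hξ
    rw [hξ, ← toReal_enorm]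
    exact ENNReal.toReal_mono hWtop ((enorm_fourier_le _ _).trans (hL1 n))
  refine ⟨latticeCount d β 1 * W.toReal, by positivity, ?_⟩
  filter_upwards [hbound] with ξ hξ
  have hsum : σ ξ = ∑ n ∈ latticeNear β 1 ξ, localized σ β χ n ξ := by
    simp only [localized]
    rw [← Finset.mul_sum, hχ.sum_eq_one fun k hk => mem_latticeNear hχ.pos hk, mul_one]
  rw [hsum]
  refine (norm_sum_le_of_le _ fun n _ => hξ n).trans ?_
  rw [Finset.sum_const, nsmul_eq_mul]
  gcongr
  exact card_latticeNear_le _ _ _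

end Wiener

/-! ### Frequency-localized pieces of a tempered distribution -/

/-- The piece `f ∗ M_{β k} χ` of a tempered distribution. -/
def piece (β : ℝ) (χ : 𝓢(Rd d, ℂ)) (f : 𝓢'(Rd d, ℂ)) (k : Fin d → ℤ) : Rd d → ℂ :=
  conv f (modulate (latticePoint β k) χ)

section Modulation

variable {p q : ℝ≥0∞} {s β : ℝ} {χ : 𝓢(Rd d, ℂ)} {f g : 𝓢'(Rd d, ℂ)}

theorem continuous_piece (f : 𝓢'(Rd d, ℂ)) (k : Fin d → ℤ) : Continuous (piece β χ f k) :=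
  continuous_conv _ _

theorem reproduced_piece (hχ : IsUniformDecomposition β χ) (f : 𝓢'(Rd d, ℂ)) (k : Fin d → ℤ) :
    Reproduced (latticePoint β k) (piece β χ f k) := by
  intro x
  have : schwartzConv (modulate (latticePoint β k) (plateau d)) (modulate (latticePoint β k) χ) =
      modulate (latticePoint β k) χ := by
    refine eq_of_fourier_eq fun ξ => ?_
    rw [fourier_schwartzConv, fourier_modulate, fourier_modulate]
    by_cases h : 1 < ‖ξ - latticePoint β k‖
    · rw [hχ.support_subset _ h, mul_zero]
    · rw [fourier_plateau (by linarith [not_lt.1 h]), one_mul]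
  simp only [piece]
  rw [integral_mul_conv, this]

/-- Temperedness enters here: polynomial growth of the piece is the a priori bound for Nikolskii,
yet the constant depends neither on f nor on k. -/
theorem enorm_piece_rpow_le (hχ : IsUniformDecomposition β χ) (f : 𝓢'(Rd d, ℂ)) {P : ℝ}
    (hP : 0 < P) (hP1 : P ≤ 1) (k : Fin d → ℤ) (x : Rd d) :
    ‖piece β χ f k x‖ₑ ^ P ≤ plateauBound d * ∫⁻ y, ‖piece β χ f k y‖ₑ ^ P := by
  obtain ⟨C, N, hC, h⟩ := exists_norm_conv_le f (modulate (latticePoint β k) χ)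
  refine (reproduced_piece hχ f k).enorm_rpow_le hP hP1 (C := ENNReal.ofReal C) (by simp) N
    (fun y => ?_) x
  rw [← ofReal_norm, ← ofReal_norm, ← ENNReal.ofReal_one,
    ← ENNReal.ofReal_add zero_le_one (norm_nonneg _), ← ENNReal.ofReal_pow (by positivity),
    ← ENNReal.ofReal_mul hC]
  exact ENNReal.ofReal_le_ofReal (h y)

theorem lintegral_piece_rpow_le (hχ : IsUniformDecomposition β χ) (f : 𝓢'(Rd d, ℂ)) {P : ℝ}
    (hP : 0 < P) (hP1 : P ≤ 1) (k : Fin d → ℤ) :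
    (∫⁻ x, ‖piece β χ f k x‖ₑ) ^ P ≤
      plateauBound d ^ (1 - P) * ∫⁻ y, ‖piece β χ f k y‖ₑ ^ P :=
  lintegral_rpow_le_mul_lintegral_rpow hP hP1 (plateauBound_ne_top d) (plateauBound_ne_zero d)
    (enorm_piece_rpow_le hχ f hP hP1 k)

/-! ### Gluing the Fourier transforms of the pieces -/

theorem fourier_piece_mul {k m : Fin d → ℤ} (hk : Integrable (piece β χ f k)) (ξ : Rd d) :
    𝓕 (modulate (latticePoint β m) χ) ξ * 𝓕 (piece β χ f k) ξ =
      𝓕 (conv f (schwartzConv (modulate (latticePoint β m) χ)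
        (modulate (latticePoint β k) χ))) ξ := by
  have h1 : conv f (schwartzConv (modulate (latticePoint β m) χ)
      (modulate (latticePoint β k) χ)) =
      MeasureTheory.convolution (modulate (latticePoint β m) χ) (piece β χ f k)
        (ContinuousLinearMap.mul ℂ ℂ) volume :=
    funext fun x => (integral_mul_conv f _ _ x).symm
  rw [h1, Real.fourier_mul_convolution_eq (modulate (latticePoint β m) χ).integrable hk]
  rfl

/-- Both sides are the transform of f ∗ (M_{βm}χ ∗ M_{βk}χ), which is symmetric in k and m. This is
the compatibility that permits gluing. -/
theorem fourier_piece_symm {k m : Fin d → ℤ} (hk : Integrable (piece β χ f k))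
    (hm : Integrable (piece β χ f m)) (ξ : Rd d) :
    𝓕 χ (ξ - latticePoint β m) * 𝓕 (piece β χ f k) ξ =
      𝓕 χ (ξ - latticePoint β k) * 𝓕 (piece β χ f m) ξ := by
  rw [← fourier_modulate, ← fourier_modulate, fourier_piece_mul hk, fourier_piece_mul hm,
    schwartzConv_comm]

/-- Multiply by the partition of unity: by compatibility every term carries the factor χ̂(ξ - βk),
which vanishes. -/
theorem fourier_piece_eq_zero (hχ : IsUniformDecomposition β χ)
    (hf : ∀ k, Integrable (piece β χ f k)) {k : Fin d → ℤ} {ξ : Rd d}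
    (hξ : 1 < ‖ξ - latticePoint β k‖) : 𝓕 (piece β χ f k) ξ = 0 := by
  have h1 : HasSum (fun m => 𝓕 χ (ξ - latticePoint β m) * 𝓕 (piece β χ f k) ξ)
      (1 * 𝓕 (piece β χ f k) ξ) := (hχ.hasSum_one ξ).mul_right _
  have h2 : (fun m => 𝓕 χ (ξ - latticePoint β m) * 𝓕 (piece β χ f k) ξ) = fun _ => 0 := by
    funext m
    rw [fourier_piece_symm (hf k) (hf m), hχ.support_subset _ hξ, zero_mul]
  rw [h2, one_mul] at h1
  exact h1.unique hasSum_zero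

/-- The Fourier transform of a tempered distribution with integrable pieces, as a function. -/
def spectrumFun (β : ℝ) (χ : 𝓢(Rd d, ℂ)) (f : 𝓢'(Rd d, ℂ)) (ξ : Rd d) : ℂ :=
  ∑ᶠ k, 𝓕 (piece β χ f k) ξ

theorem spectrumFun_eq_sum (hχ : IsUniformDecomposition β χ)
    (hf : ∀ k, Integrable (piece β χ f k)) (ξ : Rd d) :
    spectrumFun β χ f ξ = ∑ k ∈ latticeNear β 1 ξ, 𝓕 (piece β χ f k) ξ := by
  refine finsum_eq_sum_of_support_subset _ fun k hk => ?_
  refine mem_latticeNear hχ.pos (not_lt.1 fun hlt => hk ?_)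
  exact fourier_piece_eq_zero hχ hf hlt

theorem spectrumFun_mul (hχ : IsUniformDecomposition β χ)
    (hf : ∀ k, Integrable (piece β χ f k)) (k : Fin d → ℤ) (ξ : Rd d) :
    𝓕 χ (ξ - latticePoint β k) * spectrumFun β χ f ξ = 𝓕 (piece β χ f k) ξ := by
  rw [spectrumFun_eq_sum hχ hf, Finset.mul_sum]
  simp only [fourier_piece_symm (hf _) (hf k)]
  rw [← Finset.sum_mul, hχ.sum_eq_one fun k hk => mem_latticeNear hχ.pos hk, one_mul]

theorem continuous_spectrumFun (hχ : IsUniformDecomposition β χ)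
    (hf : ∀ k, Integrable (piece β χ f k)) : Continuous (spectrumFun β χ f) := by
  refine continuous_finsum (fun k => continuous_fourier (hf k)) fun ξ => ?_
  -- Local finiteness: a piece whose spectrum meets the unit ball about ξ has its lattice point
  -- within 2 of ξ.
  refine ⟨Metric.ball ξ 1, Metric.ball_mem_nhds ξ one_pos,
    (latticeNear β 2 ξ).finite_toSet.subset ?_⟩
  rintro k ⟨η, hη, hη'⟩
  refine mem_latticeNear hχ.pos ?_
  have h1 : ‖η - latticePoint β k‖ ≤ 1 :=
    not_lt.1 fun hlt => hη (fourier_piece_eq_zero hχ hf hlt)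
  have h2 : ‖ξ - η‖ ≤ 1 := by
    rw [Metric.mem_ball, dist_eq_norm] at hη'
    rw [norm_sub_rev]
    exact hη'.le
  calc ‖ξ - latticePoint β k‖ = ‖(ξ - η) + (η - latticePoint β k)‖ := by congr 1; abel
    _ ≤ 1 + 1 := (norm_add_le _ _).trans (add_le_add h2 h1)
    _ = 2 := by norm_num

theorem norm_spectrumFun_le (hχ : IsUniformDecomposition β χ)
    (hf : ∀ k, Integrable (piece β χ f k)) {D : ℝ≥0∞} (hD : D ≠ ∞)
    (hfD : ∀ k, ∫⁻ x, ‖piece β χ f k x‖ₑ ≤ D) (ξ : Rd d) :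
    ‖spectrumFun β χ f ξ‖ ≤ latticeCount d β 1 * D.toReal := by
  rw [spectrumFun_eq_sum hχ hf]
  have h1 : ∀ k, ‖𝓕 (piece β χ f k) ξ‖ ≤ D.toReal := fun k => by
    rw [← toReal_enorm]
    exact ENNReal.toReal_mono hD ((enorm_fourier_le _ _).trans (hfD k))
  refine (norm_sum_le_of_le _ fun k _ => h1 k).trans ?_
  rw [Finset.sum_const, nsmul_eq_mul]
  gcongr
  exact card_latticeNear_le _ _ _

theorem spectrumFun_add (hχ : IsUniformDecomposition β χ)
    (hf : ∀ k, Integrable (piece β χ f k)) (hg : ∀ k, Integrable (piece β χ g k)) (ξ : Rd d) :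
    spectrumFun β χ (f + g) ξ = spectrumFun β χ f ξ + spectrumFun β χ g ξ := by
  have h1 : ∀ k, piece β χ (f + g) k = piece β χ f k + piece β χ g k := fun k => conv_add _ _ _
  have h2 : ∀ k, Integrable (piece β χ (f + g) k) := fun k => by
    rw [h1]; exact (hf k).add (hg k)
  rw [spectrumFun_eq_sum hχ h2, spectrumFun_eq_sum hχ hf, spectrumFun_eq_sum hχ hg,
    ← Finset.sum_add_distrib]
  refine Finset.sum_congr rfl fun k _ => ?_
  simp only [fourier_eq_character, h1, Pi.add_apply, mul_add]
  exact integral_add (integrable_character_mul _ (hf k)) (integrable_character_mul _ (hg k))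

theorem spectrumFun_smul (c : ℂ) (f : 𝓢'(Rd d, ℂ)) (ξ : Rd d) :
    spectrumFun β χ (c • f) ξ = c * spectrumFun β χ f ξ := by
  have h1 : ∀ k, piece β χ (c • f) k = c • piece β χ f k := fun k => conv_smul _ _ _
  rw [spectrumFun, spectrumFun, ← smul_eq_mul, smul_finsum]
  refine finsum_congr fun k => ?_
  simp only [fourier_eq_character, h1, Pi.smul_apply, smul_eq_mul]
  rw [← integral_const_mul]
  congr 1 with v
  ring

/-! ### Bounds on the pieces from the modulation quasi-norm -/

theorem one_le_weight (hs : 0 ≤ s) (x : Rd d) : 1 ≤ weight s x := by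
  rw [weight, ← ENNReal.ofReal_one]
  refine ENNReal.ofReal_le_ofReal (Real.one_le_rpow ?_ (by positivity))
  nlinarith [sq_nonneg ‖x‖]

theorem le_eLpNorm_count {ι : Type*} [Countable ι] [MeasurableSpace ι]
    [MeasurableSingletonClass ι] (hq : 0 < q) (a : ι → ℝ≥0∞) (i : ι) :
    a i ≤ eLpNorm a q Measure.count := by
  rcases eq_or_ne q ∞ with rfl | hq'
  · rw [eLpNorm_exponent_top]
    have h : ∀ᵐ j ∂Measure.count, ‖a j‖ₑ ≤ eLpNormEssSup a Measure.count := ae_le_eLpNormEssSup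
    rw [ae_iff, Measure.count_eq_zero_iff] at h
    by_contra hcon
    exact (Set.mem_empty_iff_false i).1 (h ▸ hcon)
  · rw [eLpNorm_eq_lintegral_rpow_enorm_toReal hq.ne' hq', one_div,
      ENNReal.le_rpow_inv_iff (ENNReal.toReal_pos hq.ne' hq'), lintegral_count]
    exact ENNReal.le_tsum (f := fun i => ‖a i‖ₑ ^ q.toReal) i

/-- Because s ≥ 0 the weights are at least 1, and ℓ^q dominates ℓ^∞; hence the pieces are bounded
uniformly in k. -/
theorem eLpNorm_piece_le_modNorm (hs : 0 ≤ s) (hq : 0 < q) (f : 𝓢'(Rd d, ℂ)) (k : Fin d → ℤ) :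
    eLpNorm (piece β χ f k) p volume ≤ modNorm p q s β χ f :=
  (le_mul_of_one_le_left bot_le (one_le_weight hs _)).trans (le_eLpNorm_count hq
    (fun k => weight s (latticePoint β k) * eLpNorm (piece β χ f k) p volume) k)

theorem lintegral_piece_le (hχ : IsUniformDecomposition β χ) (hp : 0 < p) (hp1 : p < 1)
    (hs : 0 ≤ s) (hq : 0 < q) (f : 𝓢'(Rd d, ℂ)) (k : Fin d → ℤ) :
    ∫⁻ x, ‖piece β χ f k x‖ₑ ≤
      (plateauBound d ^ (1 - p.toReal) * modNorm p q s β χ f ^ p.toReal) ^ p.toReal⁻¹ := by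
  obtain ⟨hP, hP1⟩ := toReal_mem_Ioo hp hp1
  rw [ENNReal.le_rpow_inv_iff hP]
  refine (lintegral_piece_rpow_le hχ f hP hP1 k).trans ?_
  rw [lintegral_enorm_rpow_eq hp hp1]
  gcongr
  exact eLpNorm_piece_le_modNorm hs hq f k

theorem exists_lintegral_piece_le (hχ : IsUniformDecomposition β χ) (hp : 0 < p) (hp1 : p < 1)
    (hs : 0 ≤ s) (hq : 0 < q) (hf : f ∈ modulationSpace p q s β χ) :
    ∃ D : ℝ≥0∞, D ≠ ∞ ∧ ∀ k, ∫⁻ x, ‖piece β χ f k x‖ₑ ≤ D := by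
  obtain ⟨hP, hP1⟩ := toReal_mem_Ioo hp hp1
  exact ⟨_, ENNReal.rpow_ne_top_of_nonneg (by positivity) (ENNReal.mul_ne_top
    (ENNReal.rpow_ne_top_of_nonneg (by linarith) (plateauBound_ne_top d))
    (ENNReal.rpow_ne_top_of_nonneg hP.le hf.2.ne)), lintegral_piece_le hχ hp hp1 hs hq f⟩

theorem integrable_piece (hχ : IsUniformDecomposition β χ) (hp : 0 < p) (hp1 : p < 1)
    (hs : 0 ≤ s) (hq : 0 < q) (hf : f ∈ modulationSpace p q s β χ) (k : Fin d → ℤ) :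
    Integrable (piece β χ f k) := by
  obtain ⟨D, hD, h⟩ := exists_lintegral_piece_le hχ hp hp1 hs hq hf
  exact ⟨(continuous_piece f k).aestronglyMeasurable, (h k).trans_lt hD.lt_top⟩

end Modulation

/-! ### Schwartz functions in modulation spaces -/

theorem conv_coe (f φ : 𝓢(Rd d, ℂ)) : conv (f : 𝓢'(Rd d, ℂ)) φ = schwartzConv f φ := by
  funext x
  rw [conv, SchwartzMap.coe_apply, schwartzConv_apply]
  congr 1 with y
  rw [reflectAt_apply, smul_eq_mul, mul_comm]

/-- Leibniz together with (1 + ‖a‖)^N ≤ (1 + ‖x‖)^N (1 + ‖x - a‖)^N, each factor being absorbed by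
the decay of u or v. With u = f̂ and v = χ̂ it yields rapid decay in k of the pieces of a Schwartz
function. -/
theorem exists_iteratedFDeriv_mul_translate_le (u v : 𝓢(Rd d, ℂ)) (N k n : ℕ) :
    ∃ C : ℝ, 0 ≤ C ∧ ∀ a x : Rd d, (1 + ‖a‖) ^ N *
      (‖x‖ ^ k * ‖iteratedFDeriv ℝ n (fun ξ => u ξ * v (ξ - a)) x‖) ≤ C := by
  choose C₁ hC₁ h₁ using fun i => exists_bound_one_add_norm_pow_mul u (N + k) i
  choose C₂ hC₂ h₂ using fun i => exists_bound_one_add_norm_pow_mul v N i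
  refine ⟨∑ i ∈ Finset.range (n + 1), (n.choose i : ℝ) * C₁ i * C₂ (n - i),
    Finset.sum_nonneg fun i _ => mul_nonneg (mul_nonneg (by positivity) (hC₁ i)) (hC₂ _),
    fun a x => ?_⟩
  have hv : ContDiff ℝ n fun ξ => v (ξ - a) := (v.smooth n).comp (contDiff_id.sub contDiff_const)
  have hL := norm_iteratedFDeriv_mul_le (𝕜 := ℝ) (N := n) (u.smooth n) hv x le_rfl
  calc _ ≤ (1 + ‖a‖) ^ N * (‖x‖ ^ k * ∑ i ∈ Finset.range (n + 1),
      (n.choose i : ℝ) * ‖iteratedFDeriv ℝ i u x‖ *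
        ‖iteratedFDeriv ℝ (n - i) (fun ξ => v (ξ - a)) x‖) := by gcongr
    _ = ∑ i ∈ Finset.range (n + 1), (1 + ‖a‖) ^ N * (‖x‖ ^ k * ((n.choose i : ℝ) *
        ‖iteratedFDeriv ℝ i u x‖ * ‖iteratedFDeriv ℝ (n - i) v (x - a)‖)) := by
        rw [Finset.mul_sum, Finset.mul_sum]
        refine Finset.sum_congr rfl fun i _ => ?_
        rw [iteratedFDeriv_comp_sub]
    _ ≤ _ := by
        refine Finset.sum_le_sum fun i _ => ?_
        calc _ ≤ ((1 + ‖x‖) ^ N * (1 + ‖x - a‖) ^ N) * ((1 + ‖x‖) ^ k * ((n.choose i : ℝ) *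
            ‖iteratedFDeriv ℝ i u x‖ * ‖iteratedFDeriv ℝ (n - i) v (x - a)‖)) := by
              gcongr
              · have := one_add_norm_pow_le_mul a x N
                rwa [norm_sub_rev] at this
              · linarith
          _ = (n.choose i : ℝ) * ((1 + ‖x‖) ^ (N + k) * ‖iteratedFDeriv ℝ i u x‖) *
              ((1 + ‖x - a‖) ^ N * ‖iteratedFDeriv ℝ (n - i) v (x - a)‖) := by ring
          _ ≤ _ := by
              gcongr
              · exact mul_nonneg (by positivity) (hC₁ i)
              · exact h₁ i x
              · exact h₂ _ _

theorem exists_eLpNorm_fourierInv_le (p : ℝ≥0∞) :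
    ∃ (t : Finset (ℕ × ℕ)) (C : ℝ≥0), ∀ h : 𝓢(Rd d, ℂ),
      eLpNorm (𝓕⁻ h : 𝓢(Rd d, ℂ)) p volume ≤
        C * ENNReal.ofReal (t.sup (schwartzSeminormFamily ℂ (Rd d) ℂ) h) := by
  obtain ⟨k, C, hC⟩ := SchwartzMap.eLpNorm_le_seminorm (E := Rd d) ℂ ℂ p volume
  set r : Seminorm ℂ 𝓢(Rd d, ℂ) := ((Finset.Iic (k, 0)).sup
    (schwartzSeminormFamily ℂ (Rd d) ℂ)).comp
      (FourierTransform.fourierInvCLM ℂ 𝓢(Rd d, ℂ)).toLinearMap with hr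
  have hsup : Continuous
      ((Finset.Iic (k, 0)).sup (schwartzSeminormFamily ℂ (Rd d) ℂ) : Seminorm ℂ 𝓢(Rd d, ℂ)) :=
    Seminorm.continuous_finsetSup fun i _ =>
      (schwartz_withSeminorms ℂ (Rd d) ℂ).continuous_seminorm i
  have hrc : Continuous r := hsup.comp (FourierTransform.fourierInvCLM ℂ 𝓢(Rd d, ℂ)).continuous
  obtain ⟨t, C', -, hC'⟩ := Seminorm.bound_of_continuous (schwartz_withSeminorms ℂ (Rd d) ℂ) r hrc
  refine ⟨t, C * C', fun h => (hC _).trans ?_⟩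
  rw [ENNReal.coe_mul, mul_assoc]
  gcongr
  rw [← ENNReal.ofReal_coe_nnreal, ← ENNReal.ofReal_mul (by positivity)]
  exact ENNReal.ofReal_le_ofReal (hC' h)

theorem exists_eLpNorm_piece_coe_le (β : ℝ) (χ f : 𝓢(Rd d, ℂ)) (p : ℝ≥0∞) (N : ℕ) :
    ∃ D : ℝ≥0, ∀ k, ENNReal.ofReal ((1 + ‖latticePoint β k‖) ^ N) *
      eLpNorm (piece β χ (f : 𝓢'(Rd d, ℂ)) k) p volume ≤ D := by
  obtain ⟨t, C, hC⟩ := exists_eLpNorm_fourierInv_le (d := d) p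
  choose B hB hB' using fun i : ℕ × ℕ =>
    exists_iteratedFDeriv_mul_translate_le (𝓕 f) (𝓕 χ) N i.1 i.2
  have hBs : 0 ≤ ∑ i ∈ t, B i := Finset.sum_nonneg fun i _ => hB i
  refine ⟨C * (∑ i ∈ t, B i).toNNReal, fun k => ?_⟩
  set h : 𝓢(Rd d, ℂ) := 𝓕 (schwartzConv f (modulate (latticePoint β k) χ)) with hh
  have hpiece : piece β χ (f : 𝓢'(Rd d, ℂ)) k = (𝓕⁻ h : 𝓢(Rd d, ℂ)) := by
    rw [piece, conv_coe, hh, FourierTransform.fourierInv_fourier_eq]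
  have hfun : (h : Rd d → ℂ) = fun ξ => 𝓕 f ξ * 𝓕 χ (ξ - latticePoint β k) := by
    funext ξ
    rw [hh, fourier_schwartzConv, fourier_modulate]
  have hsem : (1 + ‖latticePoint β k‖) ^ N * t.sup (schwartzSeminormFamily ℂ (Rd d) ℂ) h ≤
      ∑ i ∈ t, B i := by
    rw [mul_comm, ← le_div_iff₀ (by positivity)]
    refine Seminorm.finset_sup_apply_le (by positivity) fun i hi => ?_
    refine SchwartzMap.seminorm_le_bound ℂ i.1 i.2 h (by positivity) fun x => ?_
    rw [le_div_iff₀ (by positivity), mul_comm, hfun]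
    exact (hB' i _ x).trans (Finset.single_le_sum (fun j _ => hB j) hi)
  rw [hpiece]
  calc _ ≤ ENNReal.ofReal ((1 + ‖latticePoint β k‖) ^ N) *
      (C * ENNReal.ofReal (t.sup (schwartzSeminormFamily ℂ (Rd d) ℂ) h)) := by
        gcongr; exact hC h
    _ = C * ENNReal.ofReal ((1 + ‖latticePoint β k‖) ^ N *
        t.sup (schwartzSeminormFamily ℂ (Rd d) ℂ) h) := by
        rw [ENNReal.ofReal_mul (by positivity)]; ring
    _ ≤ C * ENNReal.ofReal (∑ i ∈ t, B i) := by gcongr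
    _ = _ := by rw [ENNReal.coe_mul]; rfl

/-- Compare each term with an integral over the unit ball about its lattice point. These balls
overlap boundedly often, and (1 + ‖x‖)^{-r} is integrable for r > d. -/
theorem tsum_one_add_norm_latticePoint_rpow_lt_top {β : ℝ} (hβ : 0 < β) {r : ℝ}
    (hr : (d : ℝ) < r) :
    ∑' k : Fin d → ℤ, ENNReal.ofReal ((1 + ‖latticePoint β k‖) ^ (-r)) < ∞ := by
  have hr0 : 0 ≤ r := (Nat.cast_nonneg d).trans hr.le
  set V := volume (Metric.closedBall (0 : Rd d) 1) with hV
  have hV0 : V ≠ 0 := (Metric.measure_closedBall_pos volume _ one_pos).ne'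
  set g : Rd d → ℝ≥0∞ := fun x => ENNReal.ofReal ((1 + ‖x‖) ^ (-r)) with hg
  have hgm : Measurable g := by fun_prop
  set B := fun k : Fin d → ℤ => Metric.closedBall (latticePoint β k) 1
  have hterm : ∀ k, V * g (latticePoint β k) ≤
      ENNReal.ofReal (2 ^ r) * ∫⁻ x, (B k).indicator g x := by
    intro k
    rw [lintegral_indicator measurableSet_closedBall,
      ← lintegral_const_mul _ hgm, hV, ← Measure.addHaar_closedBall_center volume
        (latticePoint β k), mul_comm, ← setLIntegral_const]
    refine setLIntegral_mono (by fun_prop) fun x hx => ?_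
    rw [hg, ← ENNReal.ofReal_mul (by positivity)]
    refine ENNReal.ofReal_le_ofReal ?_
    have hx' : ‖x - latticePoint β k‖ ≤ 1 := by simpa [dist_eq_norm] using hx
    have h1 : 1 + ‖x‖ ≤ 2 * (1 + ‖latticePoint β k‖) := by
      have : ‖x‖ ≤ ‖latticePoint β k‖ + ‖x - latticePoint β k‖ := by
        calc ‖x‖ = ‖latticePoint β k + (x - latticePoint β k)‖ := by congr 1; abel
          _ ≤ _ := norm_add_le _ _
      linarith [norm_nonneg (latticePoint β k)]
    rw [Real.rpow_neg (by positivity), Real.rpow_neg (by positivity), ← div_eq_mul_inv,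
      le_div_iff₀ (by positivity), inv_mul_le_iff₀ (by positivity),
      ← Real.mul_rpow (by positivity) (by positivity), mul_comm _ (2 : ℝ)]
    exact Real.rpow_le_rpow (by positivity) h1 hr0
  have hcount : ∀ x, ∑' k, (B k).indicator g x ≤ latticeCount d β 1 * g x := by
    intro x
    rw [tsum_eq_sum (s := latticeNear β 1 x)]
    · calc _ ≤ ∑ k ∈ latticeNear β 1 x, g x :=
            Finset.sum_le_sum fun k _ => Set.indicator_le_self _ _ _
        _ ≤ _ := by
            rw [Finset.sum_const, nsmul_eq_mul]
            gcongr
            exact card_latticeNear_le _ _ _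
    · intro k hk
      refine Set.indicator_of_notMem (fun hx => hk (mem_latticeNear hβ ?_)) _
      simpa [B, dist_eq_norm] using hx
  have hfin : ∫⁻ x, g x < ∞ := finite_integral_one_add_norm (by simpa using hr)
  have hmul : V * ∑' k, g (latticePoint β k) < ∞ := by
    rw [← ENNReal.tsum_mul_left]
    calc _ ≤ ∑' k, ENNReal.ofReal (2 ^ r) * ∫⁻ x, (B k).indicator g x :=
          ENNReal.tsum_le_tsum hterm
      _ = ENNReal.ofReal (2 ^ r) * ∫⁻ x, ∑' k, (B k).indicator g x := by
          rw [ENNReal.tsum_mul_left, lintegral_tsum]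
          exact fun k => (hgm.indicator measurableSet_closedBall).aemeasurable
      _ ≤ ENNReal.ofReal (2 ^ r) * ∫⁻ x, latticeCount d β 1 * g x := by
          gcongr with x; exact hcount x
      _ < ∞ := by
          rw [lintegral_const_mul _ hgm]
          exact ENNReal.mul_lt_top ENNReal.ofReal_lt_top
            (ENNReal.mul_lt_top (ENNReal.natCast_lt_top _) hfin)
  exact lt_top_iff_ne_top.2 fun htop => by
    rw [htop, ENNReal.mul_top hV0] at hmul
    exact lt_irrefl _ hmul

theorem weight_le {s : ℝ} (hs : 0 ≤ s) (x : Rd d) :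
    weight s x ≤ ENNReal.ofReal ((1 + ‖x‖) ^ s) := by
  refine ENNReal.ofReal_le_ofReal ?_
  calc (1 + ‖x‖ ^ 2) ^ (s / 2) ≤ ((1 + ‖x‖) ^ (2 : ℝ)) ^ (s / 2) := by
        refine Real.rpow_le_rpow (by positivity) ?_ (by positivity)
        rw [Real.rpow_two]
        nlinarith [norm_nonneg x]
    _ = (1 + ‖x‖) ^ s := by
        rw [← Real.rpow_mul (by positivity)]
        congr 1
        ring

theorem coe_mem_modulationSpace {p q : ℝ≥0∞} {s β : ℝ} (hs : 0 ≤ s) (hq : 0 < q) (hβ : 0 < β)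
    (χ f : 𝓢(Rd d, ℂ)) : (f : 𝓢'(Rd d, ℂ)) ∈ modulationSpace p q s β χ := by
  refine ⟨fun k => ?_, ?_⟩
  · rw [conv_coe]
    exact SchwartzMap.memLp _ p volume
  set Q := q.toReal
  -- The exponent m absorbs the weight, and n makes the q-th powers summable. If q = ∞ then Q = 0
  -- and d / Q = 0, which is harmless since only boundedness is then needed.
  obtain ⟨m, hm⟩ := exists_nat_gt s
  obtain ⟨n, hn⟩ := exists_nat_gt ((d : ℝ) / Q)
  obtain ⟨D, hD⟩ := exists_eLpNorm_piece_coe_le β χ f p (m + n)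
  have hb : ∀ k, weight s (latticePoint β k) *
      eLpNorm (piece β χ (f : 𝓢'(Rd d, ℂ)) k) p volume ≤
      D * ENNReal.ofReal ((1 + ‖latticePoint β k‖) ^ (-(n : ℝ))) := by
    intro k
    have h1 : weight s (latticePoint β k) ≤ ENNReal.ofReal ((1 + ‖latticePoint β k‖) ^ (m + n)) *
        ENNReal.ofReal ((1 + ‖latticePoint β k‖) ^ (-(n : ℝ))) := by
      rw [← ENNReal.ofReal_mul (by positivity)]
      refine (weight_le hs _).trans (ENNReal.ofReal_le_ofReal ?_)
      rw [← Real.rpow_natCast, ← Real.rpow_add (by positivity)]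
      refine Real.rpow_le_rpow_of_exponent_le (by linarith [norm_nonneg (latticePoint β k)]) ?_
      push_cast
      linarith
    calc _ ≤ (ENNReal.ofReal ((1 + ‖latticePoint β k‖) ^ (m + n)) *
        ENNReal.ofReal ((1 + ‖latticePoint β k‖) ^ (-(n : ℝ)))) *
          eLpNorm (piece β χ (f : 𝓢'(Rd d, ℂ)) k) p volume := by gcongr
      _ = (ENNReal.ofReal ((1 + ‖latticePoint β k‖) ^ (m + n)) *
          eLpNorm (piece β χ (f : 𝓢'(Rd d, ℂ)) k) p volume) *
          ENNReal.ofReal ((1 + ‖latticePoint β k‖) ^ (-(n : ℝ))) := by ring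
      _ ≤ _ := by gcongr; exact hD k
  set a : (Fin d → ℤ) → ℝ≥0∞ := fun k => weight s (latticePoint β k) *
      eLpNorm (piece β χ (f : 𝓢'(Rd d, ℂ)) k) p volume with ha
  change eLpNorm a q Measure.count < ∞
  rcases eq_or_ne q ∞ with rfl | hq'
  · rw [eLpNorm_exponent_top]
    refine lt_of_le_of_lt (b := (D : ℝ≥0∞)) ?_ ENNReal.coe_lt_top
    refine essSup_le_of_ae_le _ (Filter.Eventually.of_forall fun k => (hb k).trans ?_)
    refine mul_le_of_le_one_right' ?_
    rw [← ENNReal.ofReal_one]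
    refine ENNReal.ofReal_le_ofReal (Real.rpow_le_one_of_one_le_of_nonpos ?_ (by simp))
    linarith [norm_nonneg (latticePoint β k)]
  · have hQ : 0 < Q := ENNReal.toReal_pos hq.ne' hq'
    rw [eLpNorm_lt_top_iff_lintegral_rpow_enorm_lt_top hq.ne' hq', lintegral_count]
    have hnQ : (d : ℝ) < n * Q := by rwa [div_lt_iff₀ hQ] at hn
    calc ∑' k, ‖a k‖ₑ ^ Q ≤ ∑' k, (D : ℝ≥0∞) ^ Q *
          ENNReal.ofReal ((1 + ‖latticePoint β k‖) ^ (-(n * Q))) := by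
          refine ENNReal.tsum_le_tsum fun k => ?_
          rw [enorm_eq_self]
          refine (ENNReal.rpow_le_rpow (hb k) hQ.le).trans_eq ?_
          rw [ENNReal.mul_rpow_of_nonneg _ _ hQ.le,
            ENNReal.ofReal_rpow_of_nonneg (by positivity) hQ.le,
            ← Real.rpow_mul (by positivity), neg_mul]
      _ < ∞ := by
          rw [ENNReal.tsum_mul_left]
          exact ENNReal.mul_lt_top (ENNReal.rpow_lt_top_of_nonneg hQ.le ENNReal.coe_ne_top)
            (tsum_one_add_norm_latticePoint_rpow_lt_top hβ hnQ)

/-! ### The multiplier on modulation spaces -/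

theorem fourierInv_reflectAt (x : Rd d) (φ : 𝓢(Rd d, ℂ)) (ξ : Rd d) :
    𝓕⁻ (reflectAt x φ) ξ = character x ξ * 𝓕 φ ξ := by
  rw [SchwartzMap.fourierInv_coe, SchwartzMap.fourier_coe, fourierInv_eq_character,
    fourier_eq_character, ← integral_sub_left_eq_self _ volume x, ← integral_const_mul]
  congr 1 with v
  rw [reflectAt_apply, sub_sub_cancel, sub_eq_add_neg, character_add_right, character_neg_left,
    character_comm x ξ, mul_assoc]

theorem integral_fourierInv_mul_eq_flip {f g : Rd d → ℂ} (hf : Integrable f) (hg : Integrable g) :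
    ∫ x, 𝓕⁻ f x * g x = ∫ ξ, f ξ * 𝓕⁻ g ξ := by
  rw [Real.fourierInv_eq_fourier_comp_neg g, ← integral_fourier_mul_eq_flip hf hg.comp_neg,
    ← integral_neg_eq_self]
  congr 1 with x
  rw [Real.fourierInv_eq_fourier_neg, neg_neg]

theorem integrable_schwartz_mul {u : Rd d → ℂ} (hu : MemLp u ∞ volume) (φ : 𝓢(Rd d, ℂ)) :
    Integrable fun ξ => φ ξ * u ξ :=
  (memLp_one_iff_integrable.1 (hu.mul (r := 1) (SchwartzMap.memLp φ 1 volume)))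

/-- The tempered distribution whose Fourier transform is the bounded function `u`. -/
def ofSpectrum (u : Rd d → ℂ) (hu : MemLp u ∞ volume) : 𝓢'(Rd d, ℂ) :=
  𝓕⁻ (Lp.toTemperedDistribution hu.toLp)

theorem ofSpectrum_apply {u : Rd d → ℂ} (hu : MemLp u ∞ volume) (φ : 𝓢(Rd d, ℂ)) :
    ofSpectrum u hu φ = ∫ ξ, 𝓕⁻ φ ξ * u ξ := by
  rw [ofSpectrum, TemperedDistribution.fourierInv_apply, Lp.toTemperedDistribution_apply]
  refine integral_congr_ae ?_
  filter_upwards [hu.coeFn_toLp] with ξ hξ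
  rw [hξ, smul_eq_mul]

theorem conv_ofSpectrum {u : Rd d → ℂ} (hu : MemLp u ∞ volume) (φ : 𝓢(Rd d, ℂ)) :
    conv (ofSpectrum u hu) φ = 𝓕⁻ fun ξ => u ξ * 𝓕 φ ξ := by
  funext x
  rw [conv, ofSpectrum_apply, fourierInv_eq_character]
  congr 1 with ξ
  rw [fourierInv_reflectAt]
  ring

theorem sum_rpow_le_sum_rpow {ι : Type*} {P : ℝ} (hP : 0 < P) (hP1 : P ≤ 1) (S : Finset ι)
    (a : ι → ℝ≥0∞) : (∑ i ∈ S, a i) ^ P ≤ ∑ i ∈ S, a i ^ P := by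
  classical
  induction S using Finset.induction_on with
  | empty => simp [hP]
  | insert i S hi ih =>
    rw [Finset.sum_insert hi, Finset.sum_insert hi]
    exact (ENNReal.rpow_add_le_add_rpow _ _ hP.le hP1).trans (by gcongr)

section Multiplier

variable {p q : ℝ≥0∞} {s β β' : ℝ} {χ χ' : 𝓢(Rd d, ℂ)} {σ : Rd d → ℂ} {f : 𝓢'(Rd d, ℂ)}

theorem MemWiener.memLp_top (hχ' : IsUniformDecomposition β' χ') (hp : 0 < p) (hp1 : p < 1)
    (hσ : MemWiener p β' χ' σ) : MemLp σ ∞ volume := by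
  obtain ⟨D, -, h⟩ := hσ.exists_ae_bound hχ' hp hp1
  exact memLp_top_of_bound hσ.1.aestronglyMeasurable D h

theorem memLp_top_spectrumFun (hχ : IsUniformDecomposition β χ) (hp : 0 < p) (hp1 : p < 1)
    (hs : 0 ≤ s) (hq : 0 < q) (hf : f ∈ modulationSpace p q s β χ) :
    MemLp (spectrumFun β χ f) ∞ volume := by
  obtain ⟨D, hD, h⟩ := exists_lintegral_piece_le hχ hp hp1 hs hq hf
  have hi := integrable_piece hχ hp hp1 hs hq hf
  exact memLp_top_of_bound (continuous_spectrumFun hχ hi).aestronglyMeasurable _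
    (Filter.Eventually.of_forall (norm_spectrumFun_le hχ hi hD h))

/-- The constant in the bound for a single piece. -/
def multiplierBound (p : ℝ≥0∞) (β' : ℝ) (χ' : 𝓢(Rd d, ℂ)) (σ : Rd d → ℂ) : ℝ≥0∞ :=
  (latticeCount d β' 2 * (plateauBound d ^ (1 - p.toReal) *
    wienerNorm p β' χ' σ ^ p.toReal)) ^ p.toReal⁻¹

theorem multiplierBound_ne_top (hp : 0 < p) (hp1 : p < 1) (hσ : MemWiener p β' χ' σ) :
    multiplierBound p β' χ' σ ≠ ∞ := by
  obtain ⟨hP, hP1⟩ := toReal_mem_Ioo hp hp1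
  exact ENNReal.rpow_ne_top_of_nonneg (by positivity) (ENNReal.mul_ne_top
    (ENNReal.natCast_ne_top _) (ENNReal.mul_ne_top
      (ENNReal.rpow_ne_top_of_nonneg (by linarith) (plateauBound_ne_top d))
      (ENNReal.rpow_ne_top_of_nonneg hP.le hσ.2.ne)))

/-- Localizing σ by the second partition of unity reduces the estimate to boundedly many
band-limited convolutions. This is also why the two admissible pairs need not be related. -/
theorem eLpNorm_fourierInv_symbol_mul_le (hχ : IsUniformDecomposition β χ)
    (hχ' : IsUniformDecomposition β' χ') (hp : 0 < p) (hp1 : p < 1)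
    (hσ : MemWiener p β' χ' σ) (hf : ∀ k, Integrable (piece β χ f k)) {k : Fin d → ℤ}
    (hm : MemLp (piece β χ f k) p volume) :
    eLpNorm (𝓕⁻ fun ξ => σ ξ * 𝓕 (piece β χ f k) ξ) p volume ≤
      multiplierBound p β' χ' σ * eLpNorm (piece β χ f k) p volume := by
  obtain ⟨hP, hP1⟩ := toReal_mem_Ioo hp hp1
  rw [← ENNReal.rpow_le_rpow_iff hP, ENNReal.mul_rpow_of_nonneg _ _ hP.le, multiplierBound,
    ← ENNReal.rpow_mul, inv_mul_cancel₀ hP.ne', ENNReal.rpow_one,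
    ← lintegral_enorm_rpow_eq hp hp1, ← lintegral_enorm_rpow_eq hp hp1]
  set P := p.toReal
  have hI : ∫⁻ x, ‖piece β χ f k x‖ₑ ^ P ≠ ∞ := by
    rw [lintegral_enorm_rpow_eq hp hp1]
    exact ENNReal.rpow_ne_top_of_nonneg hP.le hm.2.ne
  -- Radius 2: the unit balls about βk and β'n can meet only if their centres are at distance at
  -- most 2.
  set S := latticeNear β' 2 (latticePoint β k)
  set H : (Fin d → ℤ) → Rd d → ℂ := fun n ξ => localized σ β' χ' n ξ * 𝓕 (piece β χ f k) ξ
  have hint := integrable_localized hχ' hσ.1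
  have hHi : ∀ n, Integrable (H n) := fun n => by
    refine (hint n).mul_bdd (c := (∫⁻ x, ‖piece β χ f k x‖ₑ).toReal)
      (continuous_fourier (hf k)).aestronglyMeasurable (Filter.Eventually.of_forall fun ξ => ?_)
    rw [← toReal_enorm]
    exact ENNReal.toReal_mono (hf k).2.ne (enorm_fourier_le _ _)
  have hsum : (fun ξ => σ ξ * 𝓕 (piece β χ f k) ξ) = fun ξ => ∑ n ∈ S, H n ξ := by
    funext ξ
    by_cases hξ : 1 < ‖ξ - latticePoint β k‖
    · simp [H, fourier_piece_eq_zero hχ hf hξ]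
    · simp only [H, localized, ← Finset.sum_mul, ← Finset.mul_sum]
      rw [hχ'.sum_eq_one fun n hn => mem_latticeNear hχ'.pos ?_, mul_one]
      calc ‖latticePoint β k - latticePoint β' n‖
          = ‖(ξ - latticePoint β' n) - (ξ - latticePoint β k)‖ := by congr 1; abel
        _ ≤ 1 + 1 := (norm_sub_le _ _).trans (add_le_add hn (not_lt.1 hξ))
        _ = 2 := by norm_num
  have hinv : ∀ x, 𝓕⁻ (fun ξ => σ ξ * 𝓕 (piece β χ f k) ξ) x = ∑ n ∈ S, 𝓕⁻ (H n) x := by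
    intro x
    rw [hsum]
    simp only [fourierInv_eq_character, Finset.mul_sum]
    exact integral_finsetSum _ fun n _ => integrable_character_mul x (hHi n)
  have hterm : ∀ n, ∫⁻ x, ‖𝓕⁻ (H n) x‖ₑ ^ P ≤ plateauBound d ^ (1 - P) *
      wienerNorm p β' χ' σ ^ P * ∫⁻ x, ‖piece β χ f k x‖ₑ ^ P := by
    intro n
    -- Only finiteness of this bound matters: the convolution estimate requires a bounded factor,
    -- but its constant does not involve the bound.
    have hgb : ∀ y, ‖piece β χ f k y‖ₑ ≤
        (plateauBound d * ∫⁻ x, ‖piece β χ f k x‖ₑ ^ P) ^ P⁻¹ := fun y =>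
      (ENNReal.le_rpow_inv_iff hP).2 (enorm_piece_rpow_le hχ f hP hP1 k y)
    refine (lintegral_fourierInv_mul_fourier_rpow_le hP hP1 (hint n) (hf k) (continuous_piece f k)
      (ENNReal.rpow_ne_top_of_nonneg (by positivity)
        (ENNReal.mul_ne_top (plateauBound_ne_top d) hI)) hgb
      (fun ξ hξ => localized_eq_zero hχ' n hξ)
      (fun ξ hξ => fourier_piece_eq_zero hχ hf hξ)).trans ?_
    rw [mul_assoc]
    gcongr
    exact lintegral_localized_le hp hp1 n
  have hmeas : ∀ n, Measurable fun x => ‖𝓕⁻ (H n) x‖ₑ ^ P := fun n =>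
    (continuous_fourierInv (hHi n)).measurable.enorm.pow_const P
  calc _ ≤ ∫⁻ x, ∑ n ∈ S, ‖𝓕⁻ (H n) x‖ₑ ^ P := by
        refine lintegral_mono fun x => ?_
        rw [hinv]
        exact (ENNReal.rpow_le_rpow (enorm_sum_le _ _) hP.le).trans
          (sum_rpow_le_sum_rpow hP hP1 _ _)
    _ = ∑ n ∈ S, ∫⁻ x, ‖𝓕⁻ (H n) x‖ₑ ^ P := lintegral_finsetSum _ fun n _ => hmeas n
    _ ≤ ∑ n ∈ S, plateauBound d ^ (1 - P) * wienerNorm p β' χ' σ ^ P *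
        ∫⁻ x, ‖piece β χ f k x‖ₑ ^ P := Finset.sum_le_sum fun n _ => hterm n
    _ ≤ _ := by
        rw [Finset.sum_const, nsmul_eq_mul, ← mul_assoc]
        gcongr
        exact card_latticeNear_le _ _ _

/-- The multiplier `f ↦ 𝓕⁻ (σ f̂)` on distributions whose Fourier transform is bounded. -/
def multiplierDist (hσ : MemLp σ ∞ volume) (hf : MemLp (spectrumFun β χ f) ∞ volume) :
    𝓢'(Rd d, ℂ) :=
  ofSpectrum (fun ξ => spectrumFun β χ f ξ * σ ξ) (hσ.mul hf)

/-- The cutoff χ̂(· - βk) turns the glued spectrum back into 𝓕 of the k-th piece of f, so the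
operator acts piece by piece. -/
theorem piece_multiplierDist (hχ : IsUniformDecomposition β χ) (hσ : MemLp σ ∞ volume)
    (hf : MemLp (spectrumFun β χ f) ∞ volume) (hi : ∀ k, Integrable (piece β χ f k))
    (k : Fin d → ℤ) :
    piece β χ (multiplierDist hσ hf) k = 𝓕⁻ fun ξ => σ ξ * 𝓕 (piece β χ f k) ξ := by
  rw [piece, multiplierDist, conv_ofSpectrum]
  congr 1
  funext ξ
  rw [← spectrumFun_mul hχ hi, fourier_modulate]
  ring

theorem eLpNorm_piece_multiplierDist_le (hχ : IsUniformDecomposition β χ)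
    (hχ' : IsUniformDecomposition β' χ') (hp : 0 < p) (hp1 : p < 1)
    (hσ : MemWiener p β' χ' σ) (hσ' : MemLp σ ∞ volume)
    (hf : MemLp (spectrumFun β χ f) ∞ volume) (hi : ∀ k, Integrable (piece β χ f k))
    {k : Fin d → ℤ} (hm : MemLp (piece β χ f k) p volume) :
    eLpNorm (piece β χ (multiplierDist hσ' hf) k) p volume ≤
      multiplierBound p β' χ' σ * eLpNorm (piece β χ f k) p volume := by
  rw [piece_multiplierDist hχ hσ' hf hi]
  exact eLpNorm_fourierInv_symbol_mul_le hχ hχ' hp hp1 hσ hi hm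

theorem modNorm_multiplierDist_le (hχ : IsUniformDecomposition β χ)
    (hχ' : IsUniformDecomposition β' χ') (hp : 0 < p) (hp1 : p < 1)
    (hσ : MemWiener p β' χ' σ) (hσ' : MemLp σ ∞ volume)
    (hf : MemLp (spectrumFun β χ f) ∞ volume) (hi : ∀ k, Integrable (piece β χ f k))
    (hm : ∀ k, MemLp (piece β χ f k) p volume) :
    modNorm p q s β χ (multiplierDist hσ' hf) ≤
      (multiplierBound p β' χ' σ).toNNReal * modNorm p q s β χ f := by
  refine eLpNorm_le_nnreal_smul_eLpNorm_of_ae_le_mul' (Filter.Eventually.of_forall fun k => ?_) q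
  rw [enorm_eq_self, enorm_eq_self, ENNReal.coe_toNNReal (multiplierBound_ne_top hp hp1 hσ)]
  calc _ ≤ weight s (latticePoint β k) *
      (multiplierBound p β' χ' σ * eLpNorm (piece β χ f k) p volume) := by
        gcongr
        exact eLpNorm_piece_multiplierDist_le hχ hχ' hp hp1 hσ hσ' hf hi (hm k)
    _ = _ := by rw [piece]; ring

theorem multiplierDist_mem (hχ : IsUniformDecomposition β χ)
    (hχ' : IsUniformDecomposition β' χ') (hp : 0 < p) (hp1 : p < 1)
    (hσ : MemWiener p β' χ' σ) (hσ' : MemLp σ ∞ volume)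
    (hf : MemLp (spectrumFun β χ f) ∞ volume) (hi : ∀ k, Integrable (piece β χ f k))
    (hfm : f ∈ modulationSpace p q s β χ) :
    multiplierDist hσ' hf ∈ modulationSpace p q s β χ :=
  ⟨fun k => ⟨(continuous_piece _ k).aestronglyMeasurable,
    (eLpNorm_piece_multiplierDist_le hχ hχ' hp hp1 hσ hσ' hf hi (hfm.1 k)).trans_lt
      (ENNReal.mul_lt_top (multiplierBound_ne_top hp hp1 hσ).lt_top (hfm.1 k).2)⟩,
    (modNorm_multiplierDist_le hχ hχ' hp hp1 hσ hσ' hf hi hfm.1).trans_lt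
      (ENNReal.mul_lt_top ENNReal.coe_lt_top hfm.2)⟩

/-- The Fourier multiplier with symbol `σ` as a linear operator on the modulation space. -/
def multiplierOp (hs : 0 ≤ s) (hp : 0 < p) (hp1 : p < 1) (hq : 0 < q)
    (hχ : IsUniformDecomposition β χ) (hχ' : IsUniformDecomposition β' χ')
    (hσ : MemWiener p β' χ' σ) :
    modulationSpace p q s β χ →ₗ[ℂ] modulationSpace p q s β χ where
  toFun f := ⟨multiplierDist (hσ.memLp_top hχ' hp hp1)
      (memLp_top_spectrumFun hχ hp hp1 hs hq f.2),
    multiplierDist_mem hχ hχ' hp hp1 hσ _ _ (integrable_piece hχ hp hp1 hs hq f.2) f.2⟩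
  map_add' f g := by
    refine Subtype.ext (DFunLike.ext _ _ fun φ => ?_)
    have hf := integrable_piece hχ hp hp1 hs hq f.2
    have hg := integrable_piece hχ hp hp1 hs hq g.2
    have h := fun f : modulationSpace p q s β χ => integrable_schwartz_mul
      ((hσ.memLp_top hχ' hp hp1).mul (r := ∞) (memLp_top_spectrumFun hχ hp hp1 hs hq f.2)) (𝓕⁻ φ)
    refine (ofSpectrum_apply _ φ).trans (Eq.trans ?_ (congrArg₂ (· + ·) (ofSpectrum_apply _ φ)
      (ofSpectrum_apply _ φ)).symm)
    refine Eq.trans ?_ (integral_add (h f) (h g))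
    congr 1 with ξ
    have h1 := spectrumFun_add hχ hf hg ξ
    simp only [Submodule.coe_add, h1]
    ring
  map_smul' c f := by
    refine Subtype.ext (DFunLike.ext _ _ fun φ => ?_)
    refine (ofSpectrum_apply _ φ).trans (Eq.trans ?_ (congrArg (c • ·)
      (ofSpectrum_apply _ φ)).symm)
    rw [smul_eq_mul, ← integral_const_mul]
    congr 1 with ξ
    simp only [Submodule.coe_smul, spectrumFun_smul]
    ring

/-- The pieces have transforms f̂ · χ̂(· - βk), which sum to f̂. This identifies the operator with
H_σ on Schwartz functions. -/
theorem spectrumFun_coe (hχ : IsUniformDecomposition β χ) (f : 𝓢(Rd d, ℂ)) (ξ : Rd d) :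
    spectrumFun β χ (f : 𝓢'(Rd d, ℂ)) ξ = 𝓕 f ξ := by
  have hpiece : ∀ k, piece β χ (f : 𝓢'(Rd d, ℂ)) k =
      schwartzConv f (modulate (latticePoint β k) χ) := fun k => conv_coe _ _
  have hi : ∀ k, Integrable (piece β χ (f : 𝓢'(Rd d, ℂ)) k) := fun k => by
    rw [hpiece]
    exact SchwartzMap.integrable _
  rw [spectrumFun_eq_sum hχ hi]
  simp only [hpiece, ← SchwartzMap.fourier_coe, fourier_schwartzConv, fourier_modulate]
  rw [← Finset.mul_sum, hχ.sum_eq_one fun k hk => mem_latticeNear hχ.pos hk, mul_one]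

theorem integrable_symbol_mul_fourier (hσ : MemLp σ ∞ volume) (f : 𝓢(Rd d, ℂ)) :
    Integrable fun ξ => σ ξ * 𝓕 f ξ := by
  simpa only [mul_comm] using integrable_schwartz_mul hσ (𝓕 f)

theorem multiplierDist_coe_apply (hχ : IsUniformDecomposition β χ) (hσ : MemLp σ ∞ volume)
    (f : 𝓢(Rd d, ℂ)) (hf : MemLp (spectrumFun β χ (f : 𝓢'(Rd d, ℂ))) ∞ volume)
    (φ : 𝓢(Rd d, ℂ)) :
    multiplierDist hσ hf φ = ∫ x, fourierMultiplier σ f x * φ x := by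
  have h1 : ∀ x, fourierMultiplier σ f x = 𝓕⁻ (fun ξ => σ ξ * 𝓕 f ξ) x := fun x => by
    rw [fourierMultiplier, fourierInv_eq_character]
    congr 1 with ξ
    rw [character_comm x ξ]
    ring
  simp only [h1]
  rw [integral_fourierInv_mul_eq_flip (integrable_symbol_mul_fourier hσ f) φ.integrable,
    multiplierDist, ofSpectrum_apply]
  congr 1 with ξ
  rw [spectrumFun_coe hχ, SchwartzMap.fourierInv_coe]
  ring

end Multiplier

end FourierMult

end

theorem mainTheorem5 (d : ℕ) (hd : 1 ≤ d) (s : ℝ) (hs : 0 ≤ s)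
    (p q : ℝ≥0∞) (hp : 0 < p) (hp1 : p < 1) (hq : 0 < q)
    (β : ℝ) (χ : 𝓢(FourierMult.Rd d, ℂ)) (hχ : FourierMult.IsUniformDecomposition β χ)
    (β' : ℝ) (χ' : 𝓢(FourierMult.Rd d, ℂ)) (hχ' : FourierMult.IsUniformDecomposition β' χ')
    (σ : FourierMult.Rd d → ℂ) (hσ : FourierMult.MemWiener p β' χ' σ) :
    (∀ f : 𝓢(FourierMult.Rd d, ℂ), Integrable (fun ξ => σ ξ * 𝓕 f ξ) volume) ∧
    ∃ T : FourierMult.modulationSpace p q s β χ →ₗ[ℂ] FourierMult.modulationSpace p q s β χ,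
      (∀ f : 𝓢(FourierMult.Rd d, ℂ),
        ∃ hf : (f : 𝓢'(FourierMult.Rd d, ℂ)) ∈ FourierMult.modulationSpace p q s β χ,
          ∀ φ : 𝓢(FourierMult.Rd d, ℂ),
            (T ⟨(f : 𝓢'(FourierMult.Rd d, ℂ)), hf⟩ : 𝓢'(FourierMult.Rd d, ℂ)) φ =
              ∫ x, FourierMult.fourierMultiplier σ f x * φ x) ∧
      ∃ C : ℝ≥0, ∀ f : FourierMult.modulationSpace p q s β χ,
        FourierMult.modNorm p q s β χ (T f : 𝓢'(FourierMult.Rd d, ℂ)) ≤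
          C * FourierMult.modNorm p q s β χ (f : 𝓢'(FourierMult.Rd d, ℂ)) := by
  refine ⟨FourierMult.integrable_symbol_mul_fourier (hσ.memLp_top hχ' hp hp1),
    FourierMult.multiplierOp hs hp hp1 hq hχ hχ' hσ, fun f => ?_,
    (FourierMult.multiplierBound p β' χ' σ).toNNReal, fun f => ?_⟩
  · have hf := FourierMult.coe_mem_modulationSpace (p := p) hs hq hχ.pos χ f
    exact ⟨hf, FourierMult.multiplierDist_coe_apply hχ (hσ.memLp_top hχ' hp hp1) f
      (FourierMult.memLp_top_spectrumFun hχ hp hp1 hs hq hf)⟩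
  · exact FourierMult.modNorm_multiplierDist_le hχ hχ' hp hp1 hσ
      (hσ.memLp_top hχ' hp hp1) (FourierMult.memLp_top_spectrumFun hχ hp hp1 hs hq f.2)
      (FourierMult.integrable_piece hχ hp hp1 hs hq f.2) f.2.1
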